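/- Let $\pi_0$ be a probability density on $\mathbb{R}$ that is strictly decreasing on $(0,\infty)$, increasing on $(-\infty,0)$, and has polynomial tails of order $\alpha>1$: there are constants $M>0$ and $0<K_1<K_2$ with $K_1|x|^{-\alpha}\le\pi_0(x)\le K_2|x|^{-\alpha}$ for all $|x|>M$. For each $n\ge1$ let $\theta^*=\theta^{*(n)}\in\mathbb{R}^n$ be an arbitrary vector with exactly $s=s^{(n)}\ge1$ nonzero entries, where $s=o(n)$, and let the data be $D_n=y=\theta^*+\epsilon$ with $\epsilon\sim N(0,I_n)$; $E^*$ denotes expectation over $y\sim N(\theta^*,I_n)$. Let $\tau=\tau_n>0$ be deterministic, and let $\pi[\,\cdot\,|D_n]$ be the posterior distribution of $\theta\in\mathbb{R}^n$ under the model $y\,|\,\theta\sim N(\theta,I_n)$ and the prior with density $\prod_{i=1}^n\tau^{-1}\pi_0(\theta_i/\tau)$. Let $\omega>0$, $\alpha\le1+\omega/2$, and suppose that $\tau^{\alpha-1}\asymp(s/n)^c$ as $n\to\infty$ for some constant $c\in[\alpha,1+\omega/2)$, where $a_n\asymp b_n$ means $0<\liminf a_n/b_n\le\limsup a_n/b_n<\infty$.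 Then $$\lim_{n\to\infty}E^*\Big(\pi\big[\|\theta-\theta^*\|_2\ge C_1(\omega)\{s\log(n/s)\}^{1/2}\,\big|\,D_n\big]\Big)=0,\qquad C_1(\omega)=\sqrt{2+\omega}+\sqrt{\omega},$$ and $$\lim_{n\to\infty}E^*\Big(\pi\big[\|\theta-\theta^*\|_1\ge s\,C_2(\omega)\{\log(n/s)\}^{1/2}\,\big|\,D_n\big]\Big)=0,\qquad C_2(\omega)=\sqrt{2+\omega}+\sqrt{\omega^2/5}+\sqrt{\omega/5},$$ where $\lim_{\omega\downarrow0}C_1(\omega)=\lim_{\omega\downarrow0}C_2(\omega)=\sqrt2$. -/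

import Mathlib

open MeasureTheory ProbabilityTheory Filter Topology Asymptotics
open scoped ENNReal

/-- `p₀` is a probability density on `ℝ` (with respect to Lebesgue measure). -/
structure IsProbDensity (p₀ : ℝ → ℝ) : Prop where
  measurable : Measurable p₀
  nonneg : ∀ x, 0 ≤ p₀ x
  lintegral_eq_one : ∫⁻ x, ENNReal.ofReal (p₀ x) = 1

/-- The density is strictly decreasing on `(0, ∞)` and increasing on `(-∞, 0)`.
The value at `0` is unrestricted. -/
structure IsUnimodalAtZero (p₀ : ℝ → ℝ) : Prop where
  strictAntiOn : StrictAntiOn p₀ (Set.Ioi 0)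
  monotoneOn : MonotoneOn p₀ (Set.Iio 0)

/-- The tails of `p₀` decay polynomially with polynomial order `α > 1`. -/
def HasPolynomialTail (p₀ : ℝ → ℝ) (α : ℝ) : Prop :=
  1 < α ∧ ∃ M K₁ K₂ : ℝ, 0 < M ∧ 0 < K₁ ∧ K₁ < K₂ ∧
    ∀ x : ℝ, M < |x| → K₁ * |x| ^ (-α) ≤ p₀ x ∧ p₀ x ≤ K₂ * |x| ^ (-α)

/-- The law on `ℝ` with density `x ↦ (1/τ) p₀(x/τ)`. -/
noncomputable def coordPrior (p₀ : ℝ → ℝ) (τ : ℝ) : Measure ℝ :=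
  volume.withDensity fun x => ENNReal.ofReal (1 / τ * p₀ (x / τ))

/-- The prior on `ℝⁿ`: the product of `n` copies of `coordPrior p₀ τ`. -/
noncomputable def shrinkagePrior (p₀ : ℝ → ℝ) (τ : ℝ) (n : ℕ) : Measure (Fin n → ℝ) :=
  Measure.pi fun _ => coordPrior p₀ τ

/-- The law `N(θ, I_n)` of the data `y = θ + ε`, `ε ∼ N(0, I_n)`. -/
noncomputable def dataLaw {n : ℕ} (θ : Fin n → ℝ) : Measure (Fin n → ℝ) :=
  Measure.pi fun i => gaussianReal (θ i) 1

/-- The likelihood: the `N(θ, I_n)` density at `y`. -/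
noncomputable def likelihood {n : ℕ} (y θ : Fin n → ℝ) : ℝ≥0∞ :=
  ∏ i, gaussianPDF (θ i) 1 (y i)

/-- The unnormalized posterior, `likelihood × prior`. -/
noncomputable def unnormalizedPosterior (p₀ : ℝ → ℝ) (τ : ℝ) {n : ℕ} (y : Fin n → ℝ) :
    Measure (Fin n → ℝ) :=
  (shrinkagePrior p₀ τ n).withDensity fun θ => likelihood y θ

/-- The posterior law of `θ` given the data `y` (Bayes' formula). -/
noncomputable def posteriorLaw (p₀ : ℝ → ℝ) (τ : ℝ) {n : ℕ} (y : Fin n → ℝ) :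
    Measure (Fin n → ℝ) :=
  (unnormalizedPosterior p₀ τ y Set.univ)⁻¹ • unnormalizedPosterior p₀ τ y

/-- The Euclidean norm on `ℝⁿ`. -/
noncomputable def l2Norm {n : ℕ} (v : Fin n → ℝ) : ℝ := ‖WithLp.toLp 2 v‖

/-- The `ℓ¹` norm on `ℝⁿ`. -/
noncomputable def l1Norm {n : ℕ} (v : Fin n → ℝ) : ℝ := ‖WithLp.toLp 1 v‖

/-- `C₁(ω) = √(2+ω) + √ω`. -/
noncomputable def sharpC₁ (ω : ℝ) : ℝ := √(2 + ω) + √ω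

/-- `C₂(ω) = √(2+ω) + √(ω²/5) + √(ω/5)`. -/
noncomputable def sharpC₂ (ω : ℝ) : ℝ := √(2 + ω) + √(ω ^ 2 / 5) + √(ω / 5)

/-! ### Products of probability measures -/

section Pi

variable {ι : Type*} [Fintype ι] {X : ι → Type*} [∀ i, MeasurableSpace (X i)]
  (μ : (i : ι) → Measure (X i)) [∀ i, IsProbabilityMeasure (μ i)]

/-! Prior and likelihood are both products, so the posterior is a product of one-dimensional
posteriors (`posteriorLaw_eq_pi`) and the averages needed are sums over coordinates. Put L =
log(n/s), choose b strictly between c and 1 + ω/2, and set T = √(2bL). The argument is a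
first-moment bound on a loss (`coordLoss`): at a nonzero coordinate, the squared distance of θ_i
from y_i counted only beyond T, plus the squared noise; at a null coordinate, |θ_i| + θ_i².

The mean loss is O(s) (`exists_lintegral_totalLoss_le`), for two reasons. Signals
(`exists_lintegral_excessSq_coordPosterior_le`): the polynomial tail keeps the marginal density of y
above a multiple of τ^(α-1) (|y|+2)^(-α). Prior mass in the tail competes on the same scale, while
the bulk near 0, if farther than T from y, is suppressed by a Gaussian factor at most of order
(s/n)^c ≍ τ^(α-1). Hence the excess beyond T is O(1), uniformly in y. Nulls
(`exists_lintegral_null_le`): for |y| ≤ T the marginal is at least a multiple of the N(0,1) density,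
so the average over y is controlled by a fractional prior moment of order τ^q; for |y| > T the
Gaussian tail of y pays. Both contributions are O(s/n) per coordinate.

Outside the loss, only the threshold T on the s nonzero coordinates remains (and s more in ℓ¹),
giving √(2b) as leading constant in both norms. As √(2b) < √(2+ω), a violation forces the loss to be
of order sL, respectively s√L, and Markov's inequality concludes. The other summands of the two
sharp constants enter only through nonnegativity. -/

theorem lintegral_pi_prod_eq_prod (f : (i : ι) → X i → ℝ≥0∞) (hf : ∀ i, Measurable (f i)) :
    ∫⁻ x, ∏ i, f i (x i) ∂(Measure.pi μ) = ∏ i, ∫⁻ t, f i t ∂(μ i) := by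
  rw [lintegral_prod_eq_prod_lintegral_of_indepFun Finset.univ
    (fun i (x : (i : ι) → X i) => f i (x i))
    (iIndepFun_pi (fun i => (hf i).aemeasurable))
    (fun i => (hf i).comp (measurable_pi_apply i))]
  exact Finset.prod_congr rfl fun i _ => (measurePreserving_eval μ i).lintegral_comp (hf i)

theorem lintegral_pi_eval (i : ι) {f : X i → ℝ≥0∞} (hf : Measurable f) :
    ∫⁻ x, f (x i) ∂(Measure.pi μ) = ∫⁻ t, f t ∂(μ i) :=
  (measurePreserving_eval μ i).lintegral_comp hf

theorem pi_withDensity_prod (f : (i : ι) → X i → ℝ≥0∞) (hf : ∀ i, Measurable (f i))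
    (s : (i : ι) → Set (X i)) (hs : ∀ i, MeasurableSet (s i)) :
    (Measure.pi μ).withDensity (fun x => ∏ i, f i (x i)) (Set.univ.pi s)
      = ∏ i, (μ i).withDensity (f i) (s i) := by
  classical
  rw [withDensity_apply _ (MeasurableSet.univ_pi hs),
    ← lintegral_indicator (MeasurableSet.univ_pi hs)]
  have h : ∀ x : (i : ι) → X i, (Set.univ.pi s).indicator (fun x => ∏ i, f i (x i)) x
      = ∏ i, (s i).indicator (f i) (x i) := by
    intro x
    by_cases hx : x ∈ Set.univ.pi s
    · rw [Set.indicator_of_mem hx]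
      exact Finset.prod_congr rfl fun i _ => by
        rw [Set.indicator_of_mem (hx i (Set.mem_univ i))]
    · rw [Set.indicator_of_notMem hx]
      simp only [Set.mem_pi, Set.mem_univ, true_implies, not_forall] at hx
      obtain ⟨i, hi⟩ := hx
      exact (Finset.prod_eq_zero (Finset.mem_univ i) (Set.indicator_of_notMem hi _)).symm
  simp_rw [h]
  rw [lintegral_pi_prod_eq_prod μ _ fun i => (hf i).indicator (hs i)]
  exact Finset.prod_congr rfl fun i _ => by
    rw [withDensity_apply _ (hs i), lintegral_indicator (hs i)]

end Pi

/-! ### The prior of one coordinate -/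

section Prior

variable {p₀ : ℝ → ℝ} {τ : ℝ}

theorem measurable_coordPrior_density (h : IsProbDensity p₀) (τ : ℝ) :
    Measurable fun x => ENNReal.ofReal (1 / τ * p₀ (x / τ)) :=
  ((h.measurable.comp (measurable_id.div_const τ)).const_mul _).ennreal_ofReal

theorem lintegral_coordPrior_eq_mul (h : IsProbDensity p₀) (τ : ℝ) (f : ℝ → ℝ≥0∞) :
    ∫⁻ x, f x ∂(coordPrior p₀ τ) = ∫⁻ x, ENNReal.ofReal (1 / τ * p₀ (x / τ)) * f x := by
  rw [coordPrior, lintegral_withDensity_eq_lintegral_mul_non_measurable _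
    (measurable_coordPrior_density h τ) (ae_of_all _ fun _ => ENNReal.ofReal_lt_top)]
  rfl

theorem lintegral_coordPrior (h : IsProbDensity p₀) (hτ : 0 < τ) {f : ℝ → ℝ≥0∞}
    (hf : Measurable f) :
    ∫⁻ x, f x ∂(coordPrior p₀ τ) = ∫⁻ x, ENNReal.ofReal (p₀ x) * f (τ * x) := by
  rw [lintegral_coordPrior_eq_mul h]
  conv_lhs => rw [← Real.smul_map_volume_mul_left hτ.ne']
  rw [lintegral_smul_measure, lintegral_map
    (f := fun x => ENNReal.ofReal (1 / τ * p₀ (x / τ)) * f x)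
    ((measurable_coordPrior_density h τ).mul hf) (measurable_const_mul τ), smul_eq_mul, ← lintegral_const_mul' _ _ ENNReal.ofReal_ne_top]
  refine lintegral_congr fun x => ?_
  rw [← mul_assoc, ← ENNReal.ofReal_mul (abs_nonneg _), abs_of_pos hτ]
  congr 2
  field_simp

theorem isProbabilityMeasure_coordPrior (h : IsProbDensity p₀) (hτ : 0 < τ) :
    IsProbabilityMeasure (coordPrior p₀ τ) :=
  ⟨by rw [← lintegral_one, lintegral_coordPrior h hτ measurable_const]
      simpa using h.lintegral_eq_one⟩

end Prior

/-! ### The posterior of one coordinate -/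

/-- The marginal density at `y` of one observation. -/
noncomputable def marginalDensity (p₀ : ℝ → ℝ) (τ y : ℝ) : ℝ≥0∞ :=
  ∫⁻ t, gaussianPDF t 1 y ∂(coordPrior p₀ τ)

/-- The posterior law of one coordinate, given its observation `y`. -/
noncomputable def coordPosterior (p₀ : ℝ → ℝ) (τ y : ℝ) : Measure ℝ :=
  (marginalDensity p₀ τ y)⁻¹ • (coordPrior p₀ τ).withDensity fun t => gaussianPDF t 1 y

section Posterior

variable {p₀ : ℝ → ℝ} {τ : ℝ}

theorem measurable_gaussianPDF_mean (y : ℝ) : Measurable fun t => gaussianPDF t 1 y := by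
  fun_prop

theorem measurable_gaussianPDF_mean_swap :
    Measurable (Function.uncurry fun y t : ℝ => gaussianPDF t 1 y) := by
  unfold Function.uncurry
  fun_prop

theorem gaussianPDF_one_le_one (t y : ℝ) : gaussianPDF t 1 y ≤ 1 := by
  rw [gaussianPDF, ENNReal.ofReal_le_one, gaussianPDFReal]
  have h1 : (√(2 * Real.pi * (1 : NNReal)))⁻¹ ≤ 1 := by
    apply inv_le_one_of_one_le₀
    rw [Real.one_le_sqrt]
    have := Real.pi_gt_three
    push_cast
    linarith
  have h2 : Real.exp (-(y - t) ^ 2 / (2 * (1 : NNReal))) ≤ 1 := by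
    rw [Real.exp_le_one_iff]
    push_cast
    nlinarith [sq_nonneg (y - t)]
  exact mul_le_one₀ h1 (Real.exp_nonneg _) h2

theorem marginalDensity_ne_top (h : IsProbDensity p₀) (hτ : 0 < τ) (y : ℝ) :
    marginalDensity p₀ τ y ≠ ∞ := by
  have := isProbabilityMeasure_coordPrior h hτ
  refine ne_top_of_le_ne_top ENNReal.one_ne_top ?_
  calc marginalDensity p₀ τ y ≤ ∫⁻ _, 1 ∂(coordPrior p₀ τ) :=
        lintegral_mono fun t => gaussianPDF_one_le_one t y
    _ = 1 := by simp

theorem marginalDensity_ne_zero (h : IsProbDensity p₀) (hτ : 0 < τ) (y : ℝ) :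
    marginalDensity p₀ τ y ≠ 0 := by
  have := isProbabilityMeasure_coordPrior h hτ
  refine ((lintegral_pos_iff_support (measurable_gaussianPDF_mean y)).2 ?_).ne'
  have : Function.support (fun t => gaussianPDF t 1 y) = Set.univ :=
    Set.eq_univ_of_forall fun t => (gaussianPDF_pos t one_ne_zero y).ne'
  simp [this]

theorem measurable_marginalDensity (h : IsProbDensity p₀) (hτ : 0 < τ) :
    Measurable (marginalDensity p₀ τ) := by
  have := isProbabilityMeasure_coordPrior h hτ
  exact measurable_gaussianPDF_mean_swap.lintegral_prod_right

theorem lintegral_coordPosterior (p₀ : ℝ → ℝ) (τ y : ℝ) (f : ℝ → ℝ≥0∞) :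
    ∫⁻ t, f t ∂(coordPosterior p₀ τ y)
      = (marginalDensity p₀ τ y)⁻¹ * ∫⁻ t, gaussianPDF t 1 y * f t ∂(coordPrior p₀ τ) := by
  rw [coordPosterior, lintegral_smul_measure,
    lintegral_withDensity_eq_lintegral_mul_non_measurable _ (measurable_gaussianPDF_mean y)
      (ae_of_all _ fun _ => gaussianPDF_lt_top), smul_eq_mul]
  rfl

theorem isProbabilityMeasure_coordPosterior (h : IsProbDensity p₀) (hτ : 0 < τ) (y : ℝ) :
    IsProbabilityMeasure (coordPosterior p₀ τ y) :=
  ⟨by rw [← lintegral_one, lintegral_coordPosterior]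
      simp only [mul_one]
      exact ENNReal.inv_mul_cancel (marginalDensity_ne_zero h hτ y)
        (marginalDensity_ne_top h hτ y)⟩

theorem measurable_lintegral_coordPosterior (h : IsProbDensity p₀) (hτ : 0 < τ)
    {f : ℝ → ℝ → ℝ≥0∞} (hf : Measurable (Function.uncurry f)) :
    Measurable fun y => ∫⁻ t, f y t ∂(coordPosterior p₀ τ y) := by
  have := isProbabilityMeasure_coordPrior h hτ
  simp_rw [lintegral_coordPosterior]
  refine (measurable_marginalDensity h hτ).inv.mul ?_
  exact Measurable.lintegral_prod_right (measurable_gaussianPDF_mean_swap.mul hf)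

/-- The normalizing constant factors into the coordinate marginals, so both measures agree on boxes,
which determine a product measure. -/
theorem posteriorLaw_eq_pi (h : IsProbDensity p₀) (hτ : 0 < τ) {n : ℕ} (y : Fin n → ℝ) :
    posteriorLaw p₀ τ y = Measure.pi fun i => coordPosterior p₀ τ (y i) := by
  have := isProbabilityMeasure_coordPrior h hτ
  have := fun i => isProbabilityMeasure_coordPosterior h hτ (y i)
  have hZ : unnormalizedPosterior p₀ τ y Set.univ = ∏ i, marginalDensity p₀ τ (y i) := by
    rw [unnormalizedPosterior, withDensity_apply _ MeasurableSet.univ, Measure.restrict_univ]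
    exact lintegral_pi_prod_eq_prod (fun _ => coordPrior p₀ τ)
      (fun i t => gaussianPDF t 1 (y i)) fun i => measurable_gaussianPDF_mean _
  refine (Measure.pi_eq fun s hs => ?_).symm
  rw [posteriorLaw, Measure.smul_apply, hZ]
  have h1 : unnormalizedPosterior p₀ τ y (Set.univ.pi s)
      = ∏ i, (coordPrior p₀ τ).withDensity (fun t => gaussianPDF t 1 (y i)) (s i) :=
    pi_withDensity_prod (fun _ => coordPrior p₀ τ)
      (fun i t => gaussianPDF t 1 (y i)) (fun i => measurable_gaussianPDF_mean _) s hs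
  rw [h1, smul_eq_mul, ENNReal.prod_inv_distrib fun i _ j _ _ =>
    Or.inl (marginalDensity_ne_zero h hτ _), ← Finset.prod_mul_distrib]
  rfl

theorem lintegral_posteriorLaw_eval (h : IsProbDensity p₀) (hτ : 0 < τ) {n : ℕ}
    (y : Fin n → ℝ) (i : Fin n) {f : ℝ → ℝ≥0∞} (hf : Measurable f) :
    ∫⁻ t, f (t i) ∂(posteriorLaw p₀ τ y) = ∫⁻ t, f t ∂(coordPosterior p₀ τ (y i)) := by
  have := fun i => isProbabilityMeasure_coordPosterior h hτ (y i)
  rw [posteriorLaw_eq_pi h hτ]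
  exact lintegral_pi_eval (fun i => coordPosterior p₀ τ (y i)) i hf

/-- The average over data and posterior of a sum of functions of single coordinates. -/
theorem lintegral_posteriorLaw_sum (h : IsProbDensity p₀) (hτ : 0 < τ) {n : ℕ}
    (θ : Fin n → ℝ) {f : Fin n → ℝ → ℝ → ℝ≥0∞}
    (hf : ∀ i, Measurable (Function.uncurry (f i))) :
    ∫⁻ y, ∫⁻ t, ∑ i, f i (y i) (t i) ∂(posteriorLaw p₀ τ y) ∂(dataLaw θ)
      = ∑ i, ∫⁻ y, ∫⁻ t, f i y t ∂(coordPosterior p₀ τ y) ∂(gaussianReal (θ i) 1) := by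
  have hmeas : ∀ i (y : ℝ), Measurable (f i y) := fun i y => (hf i).comp measurable_prodMk_left
  have hpost := fun i => measurable_lintegral_coordPosterior h hτ (hf i)
  have h1 : ∀ y : Fin n → ℝ, ∫⁻ t, ∑ i, f i (y i) (t i) ∂(posteriorLaw p₀ τ y)
      = ∑ i, ∫⁻ t, f i (y i) t ∂(coordPosterior p₀ τ (y i)) := fun y => by
    refine (lintegral_finsetSum _ fun i _ =>
      (hmeas i (y i)).comp (measurable_pi_apply i)).trans ?_
    exact Finset.sum_congr rfl fun i _ => lintegral_posteriorLaw_eval h hτ y i (hmeas i (y i))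
  simp_rw [h1]
  refine (lintegral_finsetSum _ fun i _ => (hpost i).comp (measurable_pi_apply i)).trans ?_
  exact Finset.sum_congr rfl fun i _ => lintegral_pi_eval (fun i => gaussianReal (θ i) 1) i
    (f := fun y => ∫⁻ t, f i y t ∂(coordPosterior p₀ τ y)) (hpost i)

end Posterior

/-! ### Bounds for the marginal density of one observation -/

section MarginalBounds

variable {p₀ : ℝ → ℝ} {α M K₁ K₂ : ℝ}

theorem gaussianPDFReal_one_eq (t y : ℝ) :
    gaussianPDFReal t 1 y = (√(2 * Real.pi))⁻¹ * Real.exp (-(t - y) ^ 2 / 2) := by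
  rw [gaussianPDFReal]
  push_cast
  rw [mul_one, mul_one, ← neg_sub t y, neg_sq]

theorem gaussianPDFReal_one_le_exp (t y : ℝ) :
    gaussianPDFReal t 1 y ≤ Real.exp (-(t - y) ^ 2 / 2) := by
  rw [gaussianPDFReal_one_eq]
  refine mul_le_of_le_one_left (Real.exp_nonneg _) (inv_le_one_of_one_le₀ ?_)
  rw [Real.one_le_sqrt]
  linarith [Real.pi_gt_three]

theorem IsUnimodalAtZero.pos_of_pos (huni : IsUnimodalAtZero p₀) (hdens : IsProbDensity p₀)
    {x : ℝ} (hx : 0 < x) : 0 < p₀ x :=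
  (hdens.nonneg (x + 1)).trans_lt
    (huni.strictAntiOn (Set.mem_Ioi.2 hx) (Set.mem_Ioi.2 (by linarith)) (by linarith))

/-- The prior puts fixed mass on (0, τ]. Moving the mean from 0 to a point there changes the
Gaussian exponent by at most |y|τ + τ²/2 ≤ 3/2, so a moderate y looks almost like pure noise. -/
theorem exists_mul_gaussianPDF_le_marginalDensity (hdens : IsProbDensity p₀)
    (huni : IsUnimodalAtZero p₀) :
    ∃ m : ℝ, 0 < m ∧ ∀ τ y : ℝ, 0 < τ → τ ≤ 1 → |y| * τ ≤ 1 →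
      ENNReal.ofReal m * gaussianPDF 0 1 y ≤ marginalDensity p₀ τ y := by
  refine ⟨p₀ 1 * Real.exp (-(3 / 2)),
    mul_pos (huni.pos_of_pos hdens one_pos) (Real.exp_pos _), fun τ y hτ hτ1 hy => ?_⟩
  rw [marginalDensity, lintegral_coordPrior hdens hτ (measurable_gaussianPDF_mean y)]
  calc ENNReal.ofReal (p₀ 1 * Real.exp (-(3 / 2))) * gaussianPDF 0 1 y
      = ∫⁻ _ in Set.Ioc (0 : ℝ) 1,
          ENNReal.ofReal (p₀ 1 * Real.exp (-(3 / 2))) * gaussianPDF 0 1 y := by simp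
    _ ≤ ∫⁻ x in Set.Ioc (0 : ℝ) 1, ENNReal.ofReal (p₀ x) * gaussianPDF (τ * x) 1 y := by
        refine setLIntegral_mono' measurableSet_Ioc fun x hx => ?_
        have hp : p₀ 1 ≤ p₀ x :=
          huni.strictAntiOn.antitoneOn (Set.mem_Ioi.2 hx.1) (Set.mem_Ioi.2 one_pos) hx.2
        have h1 : -(3 / 2) + -(0 - y) ^ 2 / 2 ≤ -(τ * x - y) ^ 2 / 2 := by
          have ha : -1 ≤ y * τ * x := by
            have : |y * τ * x| ≤ 1 := by
              rw [abs_mul, abs_mul, abs_of_pos hτ, abs_of_pos hx.1]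
              exact mul_le_one₀ hy hx.1.le hx.2
            exact (abs_le.1 this).1
          have hb : (τ * x) ^ 2 ≤ 1 :=
            pow_le_one₀ (mul_nonneg hτ.le hx.1.le) (mul_le_one₀ hτ1 hx.1.le hx.2)
          nlinarith
        rw [gaussianPDF, gaussianPDF, ← ENNReal.ofReal_mul
          (mul_nonneg (hdens.nonneg 1) (Real.exp_nonneg _)),
          ← ENNReal.ofReal_mul (hdens.nonneg x)]
        refine ENNReal.ofReal_le_ofReal ?_
        rw [gaussianPDFReal_one_eq, gaussianPDFReal_one_eq, mul_assoc]
        refine mul_le_mul hp ?_ (by positivity) (hdens.nonneg x)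
        rw [mul_left_comm, ← Real.exp_add]
        gcongr
    _ ≤ _ := setLIntegral_le_lintegral _ _

theorem tail_scale {τ x : ℝ}
    (htail : ∀ x : ℝ, M < |x| → K₁ * |x| ^ (-α) ≤ p₀ x ∧ p₀ x ≤ K₂ * |x| ^ (-α))
    (hτ : 0 < τ) (hx : M * τ < |x|) :
    K₁ * (τ ^ (α - 1) * |x| ^ (-α)) ≤ 1 / τ * p₀ (x / τ) ∧
      1 / τ * p₀ (x / τ) ≤ K₂ * (τ ^ (α - 1) * |x| ^ (-α)) := by
  have hx' : M < |x / τ| := by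
    rw [abs_div, abs_of_pos hτ, lt_div_iff₀ hτ]
    exact hx
  have e : |x / τ| ^ (-α) = τ * (τ ^ (α - 1) * |x| ^ (-α)) := by
    rw [abs_div, abs_of_pos hτ, Real.div_rpow (abs_nonneg _) hτ.le, Real.rpow_neg hτ.le,
      div_inv_eq_mul, Real.rpow_sub_one hτ.ne']
    field_simp
  obtain ⟨h1, h2⟩ := htail _ hx'
  rw [e] at h1 h2
  rw [one_div, inv_mul_eq_div, le_div_iff₀ hτ, div_le_iff₀ hτ]
  constructor <;> linarith

theorem exists_rpow_le_marginalDensity (hdens : IsProbDensity p₀) (hα : 1 < α)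
    (hK₁ : 0 < K₁)
    (htail : ∀ x : ℝ, M < |x| → K₁ * |x| ^ (-α) ≤ p₀ x ∧ p₀ x ≤ K₂ * |x| ^ (-α)) :
    ∃ κ : ℝ, 0 < κ ∧ ∀ τ y : ℝ, 0 < τ → M * τ < 1 →
      ENNReal.ofReal (κ * (τ ^ (α - 1) * (|y| + 2) ^ (-α))) ≤ marginalDensity p₀ τ y := by
  refine ⟨K₁ * ((√(2 * Real.pi))⁻¹ * Real.exp (-2)), by positivity, fun τ y hτ hMτ => ?_⟩
  -- A unit interval at distance 1 to 2 from y, on the side away from 0: there the tail bound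
  -- applies (|x| ≥ 1 > Mτ) and the Gaussian exponent is at least -2.
  obtain ⟨s, hs, hvol, hmem⟩ : ∃ s : Set ℝ, MeasurableSet s ∧ volume s = 1 ∧
      ∀ x ∈ s, 1 ≤ |x| ∧ |x| ≤ |y| + 2 ∧ (x - y) ^ 2 ≤ 4 := by
    rcases le_total 0 y with hy | hy
    · refine ⟨Set.Ioc (y + 1) (y + 2), measurableSet_Ioc, by simp; norm_num, fun x hx => ?_⟩
      obtain ⟨h1, h2⟩ := hx
      rw [abs_of_nonneg hy, abs_of_nonneg (by linarith : 0 ≤ x)]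
      exact ⟨by linarith, by linarith, by nlinarith⟩
    · refine ⟨Set.Ico (y - 2) (y - 1), measurableSet_Ico, by simp; norm_num, fun x hx => ?_⟩
      obtain ⟨h1, h2⟩ := hx
      rw [abs_of_nonpos hy, abs_of_nonpos (by linarith : x ≤ 0)]
      exact ⟨by linarith, by linarith, by nlinarith⟩
  rw [marginalDensity, lintegral_coordPrior_eq_mul hdens]
  refine le_trans ?_ (setLIntegral_le_lintegral s _)
  calc _ = ∫⁻ _ in s, ENNReal.ofReal
        (K₁ * ((√(2 * Real.pi))⁻¹ * Real.exp (-2)) * (τ ^ (α - 1) * (|y| + 2) ^ (-α))) := by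
        simp [hvol]
    _ ≤ _ := by
        refine setLIntegral_mono' hs fun x hx => ?_
        obtain ⟨h1, h2, h3⟩ := hmem x hx
        have ht := (tail_scale (τ := τ) (x := x) htail hτ (by linarith)).1
        rw [gaussianPDF, ← ENNReal.ofReal_mul
          (mul_nonneg (by positivity) (hdens.nonneg _))]
        refine ENNReal.ofReal_le_ofReal ?_
        rw [mul_right_comm]
        have hp : (|y| + 2) ^ (-α) ≤ |x| ^ (-α) :=
          Real.rpow_le_rpow_of_nonpos (by linarith) h2 (by linarith)
        refine mul_le_mul (le_trans ?_ ht) ?_ (by positivity)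
          (mul_nonneg (by positivity) (hdens.nonneg _))
        · gcongr
        · rw [gaussianPDFReal_one_eq]
          gcongr
          linarith

end MarginalBounds

/-! ### Posterior mass far from the observation -/

section Excess

variable {p₀ : ℝ → ℝ} {α M K₁ K₂ : ℝ}

/-- The square of `u` where `|u|` exceeds `T`, and `0` elsewhere. -/
noncomputable def excessSq (T u : ℝ) : ℝ := if T < |u| then u ^ 2 else 0

theorem excessSq_nonneg (T u : ℝ) : 0 ≤ excessSq T u := by
  unfold excessSq
  split_ifs <;> positivity

theorem measurable_excessSq (T : ℝ) : Measurable (excessSq T) :=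
  Measurable.ite (measurableSet_lt measurable_const measurable_id.abs)
    (measurable_id.pow_const 2) measurable_const

theorem sq_le_add_excessSq {T u : ℝ} (hT : 0 ≤ T) : u ^ 2 ≤ T ^ 2 + excessSq T u := by
  unfold excessSq
  split_ifs with h
  · nlinarith
  · rw [← sq_abs u]
    have := abs_nonneg u
    nlinarith

theorem abs_le_add_sqrt_excessSq {T u : ℝ} (hT : 0 ≤ T) : |u| ≤ T + √(excessSq T u) := by
  unfold excessSq
  split_ifs with h
  · rw [Real.sqrt_sq_eq_abs]
    linarith
  · simpa using h

/-- The polynomial is at most exp((α+2)|u|), and completing the square absorbs this into the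
fraction η of the Gaussian exponent. -/
theorem sq_mul_rpow_mul_exp_le {α η : ℝ} (hα : 0 ≤ α) (hη : 0 < η) (u : ℝ) :
    u ^ 2 * (|u| + 1) ^ α * Real.exp (-u ^ 2 / 2)
      ≤ Real.exp ((α + 2) ^ 2 / (2 * η)) * Real.exp (-((1 - η) * u ^ 2 / 2)) := by
  have h0 := abs_nonneg u
  have h1 : u ^ 2 * (|u| + 1) ^ α ≤ Real.exp ((α + 2) * |u|) := by
    calc u ^ 2 * (|u| + 1) ^ α ≤ (|u| + 1) ^ (2 : ℝ) * (|u| + 1) ^ α := by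
          gcongr
          rw [Real.rpow_two, ← sq_abs u]
          gcongr
          linarith
      _ = (|u| + 1) ^ (2 + α) := (Real.rpow_add (by linarith) _ _).symm
      _ ≤ Real.exp |u| ^ (2 + α) :=
          Real.rpow_le_rpow (by linarith) (Real.add_one_le_exp _) (by linarith)
      _ = Real.exp ((α + 2) * |u|) := by
          rw [← Real.exp_mul, mul_comm, add_comm]
  calc _ ≤ Real.exp ((α + 2) * |u|) * Real.exp (-u ^ 2 / 2) := by gcongr
    _ ≤ _ := by
      rw [← Real.exp_add, ← Real.exp_add, Real.exp_le_exp]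
      have h2 : (α + 2) * |u| ≤ (α + 2) ^ 2 / (2 * η) + η * |u| ^ 2 / 2 := by
        have : (α + 2) ^ 2 / (2 * η) + η * |u| ^ 2 / 2 - (α + 2) * |u|
            = ((α + 2) - η * |u|) ^ 2 / (2 * η) := by
          field_simp
          ring
        have : 0 ≤ ((α + 2) - η * |u|) ^ 2 / (2 * η) := by positivity
        linarith
      rw [sq_abs] at h2
      linarith

/-- The constant is uniform in τ, T and y because the numerator and the lower bound for the marginal
share the factor w = τ^(α-1) (|y|+2)^(-α). -/
theorem exists_lintegral_excessSq_coordPosterior_le (hdens : IsProbDensity p₀) (hα : 1 < α)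
    (hK₁ : 0 < K₁) (hK₂ : 0 < K₂)
    (htail : ∀ x : ℝ, M < |x| → K₁ * |x| ^ (-α) ≤ p₀ x ∧ p₀ x ≤ K₂ * |x| ^ (-α))
    {η A : ℝ} (hη : 0 < η) (hη1 : η < 1) (hA : 0 < A) :
    ∃ C : ℝ, 0 < C ∧ ∀ τ T y : ℝ, 0 < τ → M * τ < 1 → 0 ≤ T →
      Real.exp (-((1 - η) * T ^ 2 / 2)) ≤ A * τ ^ (α - 1) →
      ∫⁻ t, ENNReal.ofReal (excessSq T (t - y)) ∂(coordPosterior p₀ τ y)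
        ≤ ENNReal.ofReal C := by
  obtain ⟨κ, hκ, hZ⟩ := exists_rpow_le_marginalDensity hdens hα hK₁ htail
  have hint : Integrable fun u : ℝ => Real.exp (-((1 - η) * u ^ 2 / 2)) := by
    have := integrable_exp_neg_mul_sq (b := (1 - η) / 2) (by linarith)
    refine this.congr (ae_of_all _ fun u => ?_)
    simp only
    congr 1
    ring
  set G := ∫ u : ℝ, Real.exp (-((1 - η) * u ^ 2 / 2)) with hG
  have hG0 : 0 ≤ G := integral_nonneg fun _ => Real.exp_nonneg _
  set D := Real.exp ((α + 2) ^ 2 / (2 * η)) with hD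
  have hD0 : 0 < D := Real.exp_pos _
  refine ⟨3 ^ α * D * (K₂ * G + A) / κ, by positivity, fun τ T y hτ hMτ hT hexp => ?_⟩
  have := isProbabilityMeasure_coordPrior hdens hτ
  set w := τ ^ (α - 1) * (|y| + 2) ^ (-α) with hw
  have hw0 : 0 < w := by positivity
  set g : ℝ → ℝ := fun t => 1 / τ * p₀ (t / τ) with hg
  have hg0 : ∀ t, 0 ≤ g t := fun t => mul_nonneg (by positivity) (hdens.nonneg _)
  have key : ∀ t, g t * (gaussianPDFReal t 1 y * excessSq T (t - y))
      ≤ w * 3 ^ α * D * K₂ * Real.exp (-((1 - η) * (t - y) ^ 2 / 2))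
        + w * 3 ^ α * D * A * g t := by
    intro t
    have hgt := hg0 t
    by_cases hu : T < |t - y|
    swap
    · rw [excessSq, if_neg hu]
      simp only [mul_zero]
      positivity
    rw [excessSq, if_pos hu]
    set u := t - y with hu_def
    have habs : |y| + 2 ≤ (|t| + 2) * (|u| + 1) := by
      have h1 : |y| ≤ |t| + |u| := by
        have : y = t - u := by rw [hu_def]; ring
        rw [this]
        exact abs_sub _ _
      nlinarith [abs_nonneg t, abs_nonneg u, mul_nonneg (abs_nonneg t) (abs_nonneg u)]
    -- Multiplying by this factor produces the weight in y required by w; its cost in t is met by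
    -- the prior tail, its cost in u by the Gaussian.
    have hrpow : 1 ≤ (|y| + 2) ^ (-α) * ((|t| + 2) ^ α * (|u| + 1) ^ α) := by
      rw [← Real.mul_rpow (by positivity) (by positivity), Real.rpow_neg (by positivity),
        inv_mul_eq_div, one_le_div (by positivity)]
      exact Real.rpow_le_rpow (by positivity) habs (by linarith)
    have hE := sq_mul_rpow_mul_exp_le (α := α) (by linarith) hη u
    rw [← hD] at hE
    set E := Real.exp (-((1 - η) * u ^ 2 / 2)) with hE_def
    have hE0 : 0 < E := Real.exp_pos _
    have hφ := gaussianPDFReal_one_le_exp t y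
    rw [← hu_def] at hφ
    have step1 : g t * (gaussianPDFReal t 1 y * u ^ 2)
        ≤ (|y| + 2) ^ (-α) * (g t * (|t| + 2) ^ α * (D * E)) := by
      calc g t * (gaussianPDFReal t 1 y * u ^ 2)
          ≤ g t * (Real.exp (-u ^ 2 / 2) * u ^ 2) := by gcongr
        _ ≤ g t * (Real.exp (-u ^ 2 / 2) * u ^ 2)
            * ((|y| + 2) ^ (-α) * ((|t| + 2) ^ α * (|u| + 1) ^ α)) :=
            le_mul_of_one_le_right (by positivity) hrpow
        _ = (|y| + 2) ^ (-α) * (g t * (|t| + 2) ^ α *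
            (u ^ 2 * (|u| + 1) ^ α * Real.exp (-u ^ 2 / 2))) := by ring
        _ ≤ _ := by gcongr
    refine step1.trans ?_
    have h3 : (0 : ℝ) < 3 ^ α := by positivity
    -- For |t| ≥ 1 the factor τ^(α-1) comes from the prior tail. For |t| < 1 it comes from the
    -- likelihood, through |u| > T and the hypothesis on T; the prior density is kept and later
    -- integrates to 1.
    rcases le_or_gt 1 |t| with ht | ht
    · have hgt2 := (tail_scale (τ := τ) (x := t) htail hτ (by linarith)).2
      have h4 : g t * (|t| + 2) ^ α ≤ K₂ * τ ^ (α - 1) * 3 ^ α := by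
        calc g t * (|t| + 2) ^ α
            ≤ K₂ * (τ ^ (α - 1) * |t| ^ (-α)) * (3 * |t|) ^ α := by
              refine mul_le_mul hgt2 ?_ (by positivity) (by positivity)
              exact Real.rpow_le_rpow (by positivity) (by linarith) (by linarith)
          _ = K₂ * τ ^ (α - 1) * 3 ^ α * (|t| ^ (-α) * |t| ^ α) := by
              rw [Real.mul_rpow (by norm_num) (abs_nonneg _)]
              ring
          _ = K₂ * τ ^ (α - 1) * 3 ^ α := by
              rw [← Real.rpow_add (by linarith), neg_add_cancel, Real.rpow_zero, mul_one]
      have h5 : (|y| + 2) ^ (-α) * (g t * (|t| + 2) ^ α * (D * E))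
          ≤ (|y| + 2) ^ (-α) * (K₂ * τ ^ (α - 1) * 3 ^ α * (D * E)) := by gcongr
      have h6 : 0 ≤ w * 3 ^ α * D * A * g t := by positivity
      calc _ ≤ _ := h5
        _ = w * 3 ^ α * D * K₂ * E := by rw [hw]; ring
        _ ≤ _ := le_add_of_nonneg_right h6
    · have h4 : (|t| + 2) ^ α ≤ 3 ^ α :=
        Real.rpow_le_rpow (by positivity) (by linarith) (by linarith)
      have h5 : E ≤ A * τ ^ (α - 1) := by
        refine le_trans (Real.exp_le_exp.2 ?_) hexp
        have : T ^ 2 ≤ u ^ 2 := by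
          rw [← sq_abs u]
          gcongr
        have : (1 - η) * T ^ 2 ≤ (1 - η) * u ^ 2 :=
          mul_le_mul_of_nonneg_left this (by linarith)
        linarith
      have h6 : (|y| + 2) ^ (-α) * (g t * (|t| + 2) ^ α * (D * E))
          ≤ (|y| + 2) ^ (-α) * (g t * 3 ^ α * (D * (A * τ ^ (α - 1)))) := by gcongr
      have h7 : 0 ≤ w * 3 ^ α * D * K₂ * E := by positivity
      calc _ ≤ _ := h6
        _ = w * 3 ^ α * D * A * g t := by rw [hw]; ring
        _ ≤ _ := le_add_of_nonneg_left h7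
  have hgint : ∫⁻ t, ENNReal.ofReal (g t) = 1 := by
    have h := lintegral_coordPrior_eq_mul hdens τ fun _ => 1
    simp only [lintegral_one, measure_univ, mul_one] at h
    exact h.symm
  have hnum : ∫⁻ t, gaussianPDF t 1 y * ENNReal.ofReal (excessSq T (t - y))
      ∂(coordPrior p₀ τ) ≤ ENNReal.ofReal (w * 3 ^ α * D * (K₂ * G + A)) := by
    rw [lintegral_coordPrior_eq_mul hdens]
    calc _ ≤ ∫⁻ t, (ENNReal.ofReal (w * 3 ^ α * D * K₂)
              * ENNReal.ofReal (Real.exp (-((1 - η) * (t - y) ^ 2 / 2)))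
            + ENNReal.ofReal (w * 3 ^ α * D * A) * ENNReal.ofReal (g t)) := by
          refine lintegral_mono fun t => ?_
          have hg1 := hg0 t
          rw [gaussianPDF, ← ENNReal.ofReal_mul (gaussianPDFReal_nonneg _ _ _),
            ← ENNReal.ofReal_mul (hg0 t), ← ENNReal.ofReal_mul (by positivity),
            ← ENNReal.ofReal_mul (by positivity), ← ENNReal.ofReal_add (by positivity)
              (by positivity)]
          exact ENNReal.ofReal_le_ofReal (key t)
      _ = ENNReal.ofReal (w * 3 ^ α * D * K₂) * ENNReal.ofReal G
            + ENNReal.ofReal (w * 3 ^ α * D * A) := by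
          rw [lintegral_add_left (by fun_prop), lintegral_const_mul' _ _ ENNReal.ofReal_ne_top,
            lintegral_const_mul' _ _ ENNReal.ofReal_ne_top, hgint, mul_one,
            lintegral_sub_right_eq_self
              (fun u => ENNReal.ofReal (Real.exp (-((1 - η) * u ^ 2 / 2)))) y,
            ← ofReal_integral_eq_lintegral_ofReal hint (ae_of_all _ fun _ => Real.exp_nonneg _)]
      _ = _ := by
          rw [← ENNReal.ofReal_mul (by positivity), ← ENNReal.ofReal_add (by positivity)
            (by positivity)]
          congr 1
          ring
  rw [lintegral_coordPosterior, ENNReal.inv_mul_le_iff (marginalDensity_ne_zero hdens hτ y)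
    (marginalDensity_ne_top hdens hτ y)]
  calc _ ≤ _ := hnum
    _ = ENNReal.ofReal (κ * w) * ENNReal.ofReal (3 ^ α * D * (K₂ * G + A) / κ) := by
        rw [← ENNReal.ofReal_mul (by positivity)]
        congr 1
        field_simp
    _ ≤ _ := by
        gcongr
        exact hZ τ y hτ hMτ

end Excess

/-! ### Null coordinates -/

section Null

variable {p₀ : ℝ → ℝ} {α M K₁ K₂ : ℝ}

theorem integrable_exp_neg_mul_sq_div {b : ℝ} (hb : 0 < b) :
    Integrable fun u : ℝ => Real.exp (-(b * u ^ 2 / 4)) := by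
  have := integrable_exp_neg_mul_sq (b := b / 4) (by linarith)
  refine this.congr (ae_of_all _ fun u => ?_)
  simp only
  congr 1
  ring

theorem lintegral_exp_neg_mul_sq_div {b : ℝ} (hb : 0 < b) (t : ℝ) :
    ∫⁻ y : ℝ, ENNReal.ofReal (Real.exp (-(b * (t - y) ^ 2 / 4)))
      = ENNReal.ofReal (∫ u : ℝ, Real.exp (-(b * u ^ 2 / 4))) := by
  rw [lintegral_sub_left_eq_self
      (fun u => ENNReal.ofReal (Real.exp (-(b * u ^ 2 / 4)))) t,
    ← ofReal_integral_eq_lintegral_ofReal (integrable_exp_neg_mul_sq_div hb)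
      (ae_of_all _ fun _ => Real.exp_nonneg _)]

theorem sq_mul_exp_neg_le {η : ℝ} (hη : 0 < η) (u : ℝ) :
    u ^ 2 * Real.exp (-(η * u ^ 2 / 2)) ≤ 4 / η * Real.exp (-(η * u ^ 2 / 4)) := by
  have h := Real.add_one_le_exp (η * u ^ 2 / 4)
  have h1 : u ^ 2 ≤ 4 / η * Real.exp (η * u ^ 2 / 4) := by
    rw [div_mul_eq_mul_div, le_div_iff₀ hη]
    linarith
  calc _ ≤ 4 / η * Real.exp (η * u ^ 2 / 4) * Real.exp (-(η * u ^ 2 / 2)) := by gcongr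
    _ = _ := by
      rw [mul_assoc, ← Real.exp_add]
      congr 2
      ring

theorem sq_mul_gaussianPDFReal_le (t y : ℝ) :
    (t - y) ^ 2 * gaussianPDFReal t 1 y ≤ 4 * Real.exp (-(1 * (t - y) ^ 2 / 4)) := by
  have h := sq_mul_exp_neg_le one_pos (t - y)
  rw [div_one] at h
  refine le_trans ?_ h
  have := gaussianPDFReal_one_le_exp t y
  rw [one_mul, ← neg_div]
  gcongr

theorem exists_lintegral_sq_gaussianReal_le :
    ∃ C : ℝ, 0 < C ∧ ∀ t : ℝ,
      ∫⁻ y, ENNReal.ofReal ((y - t) ^ 2) ∂(gaussianReal t 1) ≤ ENNReal.ofReal C := by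
  set G := ∫ u : ℝ, Real.exp (-(1 * u ^ 2 / 4))
  have hG0 : 0 ≤ G := integral_nonneg fun _ => Real.exp_nonneg _
  refine ⟨4 * G + 1, by positivity, fun t => ?_⟩
  rw [gaussianReal_of_var_ne_zero _ one_ne_zero,
    lintegral_withDensity_eq_lintegral_mul_non_measurable _ (measurable_gaussianPDF t 1)
      (ae_of_all _ fun _ => gaussianPDF_lt_top)]
  calc _ ≤ ∫⁻ y, ENNReal.ofReal 4 * ENNReal.ofReal (Real.exp (-(1 * (t - y) ^ 2 / 4))) := by
        refine lintegral_mono fun y => ?_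
        rw [Pi.mul_apply, gaussianPDF, ← ENNReal.ofReal_mul (gaussianPDFReal_nonneg _ _ _),
          ← ENNReal.ofReal_mul (by norm_num), mul_comm, ← neg_sub t y, neg_sq]
        exact ENNReal.ofReal_le_ofReal (sq_mul_gaussianPDFReal_le t y)
    _ = ENNReal.ofReal (4 * G) := by
        rw [lintegral_const_mul' _ _ ENNReal.ofReal_ne_top,
          lintegral_exp_neg_mul_sq_div one_pos, ← ENNReal.ofReal_mul (by norm_num)]
    _ ≤ _ := ENNReal.ofReal_le_ofReal (by linarith)

theorem lintegral_mul_rpow_abs_lt_top (hdens : IsProbDensity p₀) (hM : 0 < M)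
    (hK₂ : 0 < K₂)
    (htail : ∀ x : ℝ, M < |x| → K₁ * |x| ^ (-α) ≤ p₀ x ∧ p₀ x ≤ K₂ * |x| ^ (-α))
    {q : ℝ} (hq : 0 < q) (hqα : q < α - 1) :
    ∫⁻ x, ENNReal.ofReal (p₀ x * |x| ^ q) < ∞ := by
  -- Chosen so that b(1+|x|) ≤ |x| beyond M, which turns the tail into the integrable power
  -- (1+|x|)^(-(α-q)).
  set b := M / (1 + M) with hb
  have hb0 : 0 < b := by positivity
  set B := b ^ (-(α - q)) with hB
  have hB0 : 0 < B := by positivity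
  have key : ∀ x, p₀ x * |x| ^ q ≤ M ^ q * p₀ x + K₂ * B * (1 + ‖x‖) ^ (-(α - q)) := by
    intro x
    have hp := hdens.nonneg x
    rw [Real.norm_eq_abs]
    rcases le_or_gt |x| M with hx | hx
    · have h1 : |x| ^ q ≤ M ^ q := Real.rpow_le_rpow (abs_nonneg _) hx hq.le
      have h2 : 0 ≤ K₂ * B * (1 + |x|) ^ (-(α - q)) := by positivity
      nlinarith
    · have hx0 : 0 < |x| := hM.trans hx
      have h1 : b * (1 + |x|) ≤ |x| := by
        rw [hb, div_mul_eq_mul_div, div_le_iff₀ (by positivity)]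
        nlinarith
      have h2 : |x| ^ (-(α - q)) ≤ B * (1 + |x|) ^ (-(α - q)) := by
        rw [hB, ← Real.mul_rpow hb0.le (by positivity)]
        exact Real.rpow_le_rpow_of_nonpos (by positivity) h1 (by linarith)
      have h3 : 0 ≤ M ^ q * p₀ x := by positivity
      calc p₀ x * |x| ^ q ≤ K₂ * |x| ^ (-α) * |x| ^ q := by
            gcongr
            exact (htail x hx).2
        _ = K₂ * |x| ^ (-(α - q)) := by
            rw [mul_assoc, ← Real.rpow_add hx0]
            congr 2
            ring
        _ ≤ K₂ * (B * (1 + |x|) ^ (-(α - q))) := by gcongr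
        _ ≤ _ := by linarith
  calc _ ≤ ∫⁻ x, (ENNReal.ofReal (M ^ q) * ENNReal.ofReal (p₀ x)
          + ENNReal.ofReal (K₂ * B) * ENNReal.ofReal ((1 + ‖x‖) ^ (-(α - q)))) := by
        refine lintegral_mono fun x => ?_
        have hp := hdens.nonneg x
        rw [← ENNReal.ofReal_mul (by positivity), ← ENNReal.ofReal_mul (by positivity),
          ← ENNReal.ofReal_add (by positivity) (by positivity)]
        exact ENNReal.ofReal_le_ofReal (key x)
    _ < ∞ := by
        rw [lintegral_add_left (hdens.measurable.ennreal_ofReal.const_mul _),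
          lintegral_const_mul' _ _ ENNReal.ofReal_ne_top,
          lintegral_const_mul' _ _ ENNReal.ofReal_ne_top, hdens.lintegral_eq_one, mul_one]
        refine ENNReal.add_lt_top.2 ⟨ENNReal.ofReal_lt_top, ENNReal.mul_lt_top
          ENNReal.ofReal_lt_top (finite_integral_one_add_norm ?_)⟩
        simp only [Module.finrank_self, Nat.cast_one]
        linarith

theorem exists_lintegral_rpow_abs_coordPrior_le (hdens : IsProbDensity p₀) (hM : 0 < M)
    (hK₂ : 0 < K₂)
    (htail : ∀ x : ℝ, M < |x| → K₁ * |x| ^ (-α) ≤ p₀ x ∧ p₀ x ≤ K₂ * |x| ^ (-α))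
    {q : ℝ} (hq : 0 < q) (hqα : q < α - 1) :
    ∃ C : ℝ, 0 < C ∧ ∀ τ : ℝ, 0 < τ →
      ∫⁻ t, ENNReal.ofReal (|t| ^ q) ∂(coordPrior p₀ τ) ≤ ENNReal.ofReal (C * τ ^ q) := by
  have hF := lintegral_mul_rpow_abs_lt_top hdens hM hK₂ htail hq hqα
  set F := ∫⁻ x, ENNReal.ofReal (p₀ x * |x| ^ q) with hFdef
  refine ⟨F.toReal + 1, by positivity, fun τ hτ => ?_⟩
  rw [lintegral_coordPrior hdens hτ (by fun_prop)]
  calc _ = ∫⁻ x, ENNReal.ofReal (τ ^ q) * ENNReal.ofReal (p₀ x * |x| ^ q) := by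
        refine lintegral_congr fun x => ?_
        rw [← ENNReal.ofReal_mul (hdens.nonneg x), ← ENNReal.ofReal_mul (by positivity),
          abs_mul, abs_of_pos hτ, Real.mul_rpow hτ.le (abs_nonneg _)]
        congr 1
        ring
    _ = ENNReal.ofReal (τ ^ q) * ENNReal.ofReal F.toReal := by
        rw [lintegral_const_mul' _ _ ENNReal.ofReal_ne_top, ENNReal.ofReal_toReal hF.ne]
    _ ≤ _ := by
        rw [← ENNReal.ofReal_mul (by positivity), mul_comm]
        refine ENNReal.ofReal_le_ofReal ?_
        gcongr
        linarith

/-- The prior need not have a first moment, so only |t|^q is left to it; the remaining growth is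
expressed through t - y, which the Gaussian integrates. -/
theorem abs_add_sq_le_rpow_mul {q T y t : ℝ} (hq : 0 ≤ q) (hq1 : q ≤ 1) (hT : 1 ≤ T)
    (hy : |y| ≤ T) : |t| + t ^ 2 ≤ |t| ^ q * (4 * (T ^ 2 + (t - y) ^ 2)) := by
  have hT2 : 1 ≤ T ^ 2 := one_le_pow₀ hT
  have ht := abs_nonneg t
  rw [← sq_abs t]
  rcases le_or_gt |t| 1 with h | h
  · have h1 : |t| ≤ |t| ^ q := by
      rcases ht.eq_or_lt with h0 | h0
      · rw [← h0]; positivity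
      · simpa using Real.rpow_le_rpow_of_exponent_ge h0 h hq1
    have h2 : |t| ^ q * 4 ≤ |t| ^ q * (4 * (T ^ 2 + (t - y) ^ 2)) := by
      gcongr
      nlinarith [sq_nonneg (t - y)]
    nlinarith
  · have h1 : 1 ≤ |t| ^ q := Real.one_le_rpow h.le hq
    have h2 : y ^ 2 ≤ T ^ 2 := by
      rw [← sq_abs y]
      gcongr
    have h3 : |t| + |t| ^ 2 ≤ 4 * (T ^ 2 + (t - y) ^ 2) := by
      have : |t| + |t| ^ 2 ≤ 2 * t ^ 2 := by
        rw [← sq_abs t]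
        nlinarith
      nlinarith [sq_nonneg (t - 2 * y)]
    calc _ ≤ _ := h3
      _ ≤ _ := le_mul_of_one_le_left (by positivity) h1

theorem abs_add_sq_le_add_excessSq {T y t : ℝ} (hT : 1 ≤ T) (hy : T < |y|) :
    |t| + t ^ 2 ≤ 9 * y ^ 2 + 4 * excessSq T (t - y) := by
  have h1 := sq_le_add_excessSq (T := T) (u := t - y) (by linarith)
  have h2 : T ^ 2 ≤ y ^ 2 := by
    rw [← sq_abs y]
    gcongr
  have h3 : |t| ≤ 1 + t ^ 2 := by
    rw [← sq_abs t]
    nlinarith [sq_nonneg (|t| - 1), abs_nonneg t]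
  nlinarith [sq_nonneg (t - 2 * y)]

/-- Bound for the average, over `y` distributed as pure noise, of the posterior mean of
`|t| + t ^ 2`. -/
theorem exists_lintegral_null_le (hdens : IsProbDensity p₀) (huni : IsUnimodalAtZero p₀)
    (hα : 1 < α) (hM : 0 < M) (hK₁ : 0 < K₁) (hK₂ : 0 < K₂)
    (htail : ∀ x : ℝ, M < |x| → K₁ * |x| ^ (-α) ≤ p₀ x ∧ p₀ x ≤ K₂ * |x| ^ (-α))
    {η A q : ℝ} (hη : 0 < η) (hη1 : η < 1) (hA : 0 < A) (hq : 0 < q) (hq1 : q ≤ 1)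
    (hqα : q < α - 1) :
    ∃ C : ℝ, 0 < C ∧ ∀ τ T : ℝ, 0 < τ → τ ≤ 1 → M * τ < 1 → 1 ≤ T → T * τ ≤ 1 →
      Real.exp (-((1 - η) * T ^ 2 / 2)) ≤ A * τ ^ (α - 1) →
      ∫⁻ y, ∫⁻ t, ENNReal.ofReal (|t| + t ^ 2) ∂(coordPosterior p₀ τ y) ∂(gaussianReal 0 1)
        ≤ ENNReal.ofReal (C * (T ^ 2 * τ ^ q + Real.exp (-((1 - η) * T ^ 2 / 2)))) := by
  obtain ⟨m, hm, hmZ⟩ := exists_mul_gaussianPDF_le_marginalDensity hdens huni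
  obtain ⟨C₀, hC₀, hexc⟩ := exists_lintegral_excessSq_coordPosterior_le hdens hα hK₁ hK₂
    htail hη hη1 hA
  obtain ⟨C₁, hC₁, hmom⟩ := exists_lintegral_rpow_abs_coordPrior_le hdens hM hK₂ htail hq hqα
  set G := ∫ u : ℝ, Real.exp (-(1 * u ^ 2 / 4)) with hG
  set G' := ∫ u : ℝ, Real.exp (-(η * u ^ 2 / 4)) with hG'
  have hG0 : 0 ≤ G := integral_nonneg fun _ => Real.exp_nonneg _
  have hG'0 : 0 ≤ G' := integral_nonneg fun _ => Real.exp_nonneg _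
  set a := m⁻¹ * (20 * G) * C₁ with ha
  set b := (9 + 4 * C₀) * (4 / η) * G' with hb
  have ha0 : 0 ≤ a := by positivity
  have hb0 : 0 ≤ b := by positivity
  refine ⟨a + b + 1, by positivity, fun τ T hτ hτ1 hMτ hT hTτ hexp => ?_⟩
  have := isProbabilityMeasure_coordPrior hdens hτ
  set E := Real.exp (-((1 - η) * T ^ 2 / 2)) with hE
  have hE0 : 0 < E := Real.exp_pos _
  rw [gaussianReal_of_var_ne_zero _ one_ne_zero,
    lintegral_withDensity_eq_lintegral_mul_non_measurable _ (measurable_gaussianPDF 0 1)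
      (ae_of_all _ fun _ => gaussianPDF_lt_top)]
  set J : ℝ → ℝ≥0∞ := fun y => ∫⁻ t, gaussianPDF t 1 y *
    ENNReal.ofReal (|t| ^ q * (4 * (T ^ 2 + (t - y) ^ 2))) ∂(coordPrior p₀ τ) with hJ
  have hJmeas₂ : Measurable (Function.uncurry fun y t : ℝ => gaussianPDF t 1 y *
      ENNReal.ofReal (|t| ^ q * (4 * (T ^ 2 + (t - y) ^ 2)))) :=
    measurable_gaussianPDF_mean_swap.mul (by fun_prop)
  have hJmeas : Measurable J := hJmeas₂.lintegral_prod_right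
  have key : ∀ y, gaussianPDF 0 1 y *
      ∫⁻ t, ENNReal.ofReal (|t| + t ^ 2) ∂(coordPosterior p₀ τ y)
      ≤ ENNReal.ofReal m⁻¹ * J y + ENNReal.ofReal ((9 + 4 * C₀) * (4 / η) * E) *
        ENNReal.ofReal (Real.exp (-(η * (0 - y) ^ 2 / 4))) := by
    intro y
    -- For moderate y the noise density cancels against the marginal, leaving a factor 1/m. For
    -- large y the posterior mean is O(y²) by the excess bound.
    rcases le_or_gt |y| T with hy | hy
    · refine le_add_right ?_
      have hZ := hmZ τ y hτ hτ1 ((mul_le_mul_of_nonneg_right hy hτ.le).trans hTτ)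
      rw [lintegral_coordPosterior, ← mul_assoc]
      refine mul_le_mul' ?_ (lintegral_mono fun t => ?_)
      · rw [← div_eq_mul_inv]
        refine ENNReal.div_le_of_le_mul ?_
        rw [ENNReal.ofReal_inv_of_pos hm, mul_comm, ← div_eq_mul_inv,
          ENNReal.le_div_iff_mul_le (Or.inl (by simpa using hm))
            (Or.inl ENNReal.ofReal_ne_top), mul_comm]
        exact hZ
      · gcongr
        exact abs_add_sq_le_rpow_mul hq.le hq1 hT hy
    · refine le_add_left ?_
      have := isProbabilityMeasure_coordPosterior hdens hτ y
      have hy2 : 1 ≤ y ^ 2 := by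
        rw [← sq_abs y]
        exact one_le_pow₀ (hT.trans hy.le)
      have h1 : ∫⁻ t, ENNReal.ofReal (|t| + t ^ 2) ∂(coordPosterior p₀ τ y)
          ≤ ENNReal.ofReal ((9 + 4 * C₀) * y ^ 2) := by
        calc _ ≤ ∫⁻ t, (ENNReal.ofReal (9 * y ^ 2)
              + ENNReal.ofReal 4 * ENNReal.ofReal (excessSq T (t - y)))
                ∂(coordPosterior p₀ τ y) := by
              refine lintegral_mono fun t => ?_
              have := excessSq_nonneg T (t - y)
              rw [← ENNReal.ofReal_mul (by norm_num), ← ENNReal.ofReal_add (by positivity)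
                (by positivity)]
              exact ENNReal.ofReal_le_ofReal (abs_add_sq_le_add_excessSq hT hy)
          _ ≤ ENNReal.ofReal (9 * y ^ 2) + ENNReal.ofReal 4 * ENNReal.ofReal C₀ := by
              rw [lintegral_add_left measurable_const,
                lintegral_const_mul' _ _ ENNReal.ofReal_ne_top, lintegral_const,
                measure_univ, mul_one]
              gcongr
              exact hexc τ T y hτ hMτ (by linarith) hexp
          _ ≤ _ := by
              rw [← ENNReal.ofReal_mul (by norm_num), ← ENNReal.ofReal_add (by positivity)
                (by positivity)]
              exact ENNReal.ofReal_le_ofReal (by nlinarith)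
      refine (mul_le_mul_right h1 _).trans ?_
      rw [gaussianPDF, ← ENNReal.ofReal_mul (gaussianPDFReal_nonneg _ _ _),
        ← ENNReal.ofReal_mul (by positivity)]
      refine ENNReal.ofReal_le_ofReal ?_
      have h2 := gaussianPDFReal_one_le_exp 0 y
      have h3 := sq_mul_exp_neg_le hη (0 - y)
      have h4 : Real.exp (-((1 - η) * (0 - y) ^ 2 / 2)) ≤ E := by
        refine Real.exp_le_exp.2 ?_
        have : T ^ 2 ≤ (0 - y) ^ 2 := by
          rw [zero_sub, neg_sq, ← sq_abs y]
          gcongr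
        have := mul_le_mul_of_nonneg_left this (by linarith : 0 ≤ 1 - η)
        linarith
      -- The Gaussian exponent is split: the fraction η absorbs y² and stays integrable, the
      -- fraction 1 - η yields E because |y| > T.
      calc _ ≤ Real.exp (-(0 - y) ^ 2 / 2) * ((9 + 4 * C₀) * y ^ 2) := by gcongr
        _ = (9 + 4 * C₀) * ((0 - y) ^ 2 * Real.exp (-(η * (0 - y) ^ 2 / 2)))
            * Real.exp (-((1 - η) * (0 - y) ^ 2 / 2)) := by
          have : Real.exp (-(0 - y) ^ 2 / 2) = Real.exp (-(η * (0 - y) ^ 2 / 2))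
              * Real.exp (-((1 - η) * (0 - y) ^ 2 / 2)) := by
            rw [← Real.exp_add]
            congr 1
            ring
          rw [this]
          ring
        _ ≤ (9 + 4 * C₀) * (4 / η * Real.exp (-(η * (0 - y) ^ 2 / 4))) * E := by gcongr
        _ = _ := by ring
  have hJint : ∫⁻ y, J y ≤ ENNReal.ofReal (T ^ 2 * (20 * G) * (C₁ * τ ^ q)) := by
    -- Integrating over y first removes the Gaussian and leaves only the q-th prior moment.
    rw [hJ, lintegral_lintegral_swap hJmeas₂.aemeasurable]
    have h1 : ∀ t : ℝ, ∫⁻ y, gaussianPDF t 1 y *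
        ENNReal.ofReal (|t| ^ q * (4 * (T ^ 2 + (t - y) ^ 2)))
        ≤ ENNReal.ofReal (T ^ 2 * (20 * G)) * ENNReal.ofReal (|t| ^ q) := by
      intro t
      calc _ ≤ ∫⁻ y, ENNReal.ofReal (T ^ 2 * 20 * |t| ^ q) *
              ENNReal.ofReal (Real.exp (-(1 * (t - y) ^ 2 / 4))) := by
            refine lintegral_mono fun y => ?_
            rw [gaussianPDF, ← ENNReal.ofReal_mul (gaussianPDFReal_nonneg _ _ _),
              ← ENNReal.ofReal_mul (by positivity)]
            refine ENNReal.ofReal_le_ofReal ?_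
            have h2 := sq_mul_gaussianPDFReal_le t y
            have h3 := gaussianPDFReal_one_le_exp t y
            have h4 : Real.exp (-(t - y) ^ 2 / 2) ≤ Real.exp (-(1 * (t - y) ^ 2 / 4)) := by
              refine Real.exp_le_exp.2 ?_
              nlinarith [sq_nonneg (t - y)]
            set e := Real.exp (-(1 * (t - y) ^ 2 / 4))
            have he : 0 < e := Real.exp_pos _
            have hT2 : 1 ≤ T ^ 2 := one_le_pow₀ hT
            have h5 : gaussianPDFReal t 1 y * (4 * (T ^ 2 + (t - y) ^ 2)) ≤ T ^ 2 * 20 * e := by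
              have h6 : T ^ 2 * gaussianPDFReal t 1 y ≤ T ^ 2 * e := by
                gcongr
                exact h3.trans h4
              have h7 : e ≤ T ^ 2 * e := le_mul_of_one_le_left he.le hT2
              nlinarith
            calc _ = |t| ^ q * (gaussianPDFReal t 1 y * (4 * (T ^ 2 + (t - y) ^ 2))) := by ring
              _ ≤ |t| ^ q * (T ^ 2 * 20 * e) := by gcongr
              _ = _ := by ring
        _ = _ := by
            rw [lintegral_const_mul' _ _ ENNReal.ofReal_ne_top,
              lintegral_exp_neg_mul_sq_div one_pos, ← ENNReal.ofReal_mul (by positivity),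
              ← ENNReal.ofReal_mul (by positivity)]
            congr 1
            ring
    calc _ ≤ ∫⁻ t, ENNReal.ofReal (T ^ 2 * (20 * G)) * ENNReal.ofReal (|t| ^ q)
            ∂(coordPrior p₀ τ) := lintegral_mono h1
      _ ≤ _ := by
          rw [lintegral_const_mul' _ _ ENNReal.ofReal_ne_top,
            ENNReal.ofReal_mul (by positivity : 0 ≤ T ^ 2 * (20 * G))]
          gcongr
          exact hmom τ hτ
  calc _ ≤ ∫⁻ y, (ENNReal.ofReal m⁻¹ * J y + ENNReal.ofReal ((9 + 4 * C₀) * (4 / η) * E) *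
        ENNReal.ofReal (Real.exp (-(η * (0 - y) ^ 2 / 4)))) := lintegral_mono key
    _ ≤ ENNReal.ofReal m⁻¹ * ENNReal.ofReal (T ^ 2 * (20 * G) * (C₁ * τ ^ q))
        + ENNReal.ofReal ((9 + 4 * C₀) * (4 / η) * E) * ENNReal.ofReal G' := by
        rw [lintegral_add_left (hJmeas.const_mul _),
          lintegral_const_mul' _ _ ENNReal.ofReal_ne_top,
          lintegral_const_mul' _ _ ENNReal.ofReal_ne_top, lintegral_exp_neg_mul_sq_div hη]
        gcongr
    _ = ENNReal.ofReal (a * (T ^ 2 * τ ^ q) + b * E) := by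
        rw [← ENNReal.ofReal_mul (by positivity), ← ENNReal.ofReal_mul (by positivity),
          ← ENNReal.ofReal_add (by positivity) (by positivity)]
        congr 1
        rw [ha, hb]
        ring
    _ ≤ _ := by
        refine ENNReal.ofReal_le_ofReal ?_
        have h1 : 0 ≤ T ^ 2 * τ ^ q := by positivity
        nlinarith [mul_nonneg ha0 hE0.le, mul_nonneg hb0 h1]

end Null

/-! ### A loss that controls both norms -/

section Loss

/-- The loss of a parameter `t` at one coordinate with truth `a` and observation `y`. -/
noncomputable def coordLoss (T a y t : ℝ) : ℝ :=
  if a ≠ 0 then excessSq T (t - y) + (y - a) ^ 2 else |t| + t ^ 2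

theorem coordLoss_nonneg (T a y t : ℝ) : 0 ≤ coordLoss T a y t := by
  have := excessSq_nonneg T (t - y)
  unfold coordLoss
  split_ifs <;> positivity

theorem measurable_coordLoss (T a : ℝ) :
    Measurable (Function.uncurry fun y t => ENNReal.ofReal (coordLoss T a y t)) := by
  have h := (measurable_excessSq T).comp (measurable_snd.sub measurable_fst :
    Measurable fun p : ℝ × ℝ => p.2 - p.1)
  refine Measurable.ennreal_ofReal ?_
  by_cases ha : a ≠ 0
  · simp only [coordLoss, if_pos ha]
    exact h.add (by fun_prop)
  · simp only [coordLoss, if_neg ha]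
    fun_prop

/-- The sum of the coordinate losses. -/
noncomputable def totalLoss {n : ℕ} (T : ℝ) (a y θ : Fin n → ℝ) : ℝ :=
  ∑ i, coordLoss T (a i) (y i) (θ i)

theorem totalLoss_nonneg {n : ℕ} (T : ℝ) (a y θ : Fin n → ℝ) : 0 ≤ totalLoss T a y θ :=
  Finset.sum_nonneg fun _ _ => coordLoss_nonneg _ _ _ _

/-- One remainder w serves both norms: its square is controlled for ℓ², and w itself for ℓ¹, where x
≤ x² + 1/4 costs a constant at each nonzero coordinate. -/
theorem exists_abs_sub_le_add {T : ℝ} (hT : 0 ≤ T) (a y t : ℝ) :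
    ∃ w : ℝ, |t - a| ≤ (if a ≠ 0 then T else 0) + w ∧ 0 ≤ w ∧
      w ^ 2 ≤ 2 * coordLoss T a y t ∧ w ≤ (if a ≠ 0 then 1 else 0) + coordLoss T a y t := by
  by_cases ha : a ≠ 0
  · have h0 := excessSq_nonneg T (t - y)
    have h1 := abs_le_add_sqrt_excessSq (u := t - y) hT
    have h2 : |t - a| ≤ |t - y| + |y - a| := abs_sub_le t y a
    have h3 := Real.sq_sqrt h0
    refine ⟨√(excessSq T (t - y)) + |y - a|, ?_, by positivity, ?_, ?_⟩
    · rw [if_pos ha]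
      linarith
    · rw [coordLoss, if_pos ha, ← sq_abs (y - a)]
      nlinarith [sq_nonneg (√(excessSq T (t - y)) - |y - a|)]
    · rw [coordLoss, if_pos ha, if_pos ha, ← sq_abs (y - a)]
      nlinarith [sq_nonneg (√(excessSq T (t - y)) - 1 / 2), sq_nonneg (|y - a| - 1 / 2)]
  · have h0 : a = 0 := not_not.1 ha
    refine ⟨|t|, ?_, abs_nonneg _, ?_, ?_⟩
    · simp [h0]
    · rw [coordLoss, if_neg ha, sq_abs]
      nlinarith [abs_nonneg t, sq_nonneg t]
    · rw [coordLoss, if_neg ha, if_neg ha]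
      nlinarith [sq_nonneg t]

variable {n : ℕ} {s : ℕ} {a : Fin n → ℝ}

theorem sum_ite_ne_zero (hs : (Finset.univ.filter fun i => a i ≠ 0).card = s) (r : ℝ) :
    ∑ i, (if a i ≠ 0 then r else 0) = s * r := by
  rw [← Finset.sum_filter, Finset.sum_const, nsmul_eq_mul, hs]

theorem l2Norm_eq (v : Fin n → ℝ) : l2Norm v = √(∑ i, v i ^ 2) := by
  rw [l2Norm, EuclideanSpace.norm_eq]
  simp

/-- Minkowski's inequality for whole vectors keeps the coefficient of √s T equal to 1; squaring
coordinatewise with (x+y)² ≤ 2x² + 2y² would spoil the sharp constant. -/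
theorem l2Norm_sub_le (hs : (Finset.univ.filter fun i => a i ≠ 0).card = s) {T : ℝ}
    (hT : 0 ≤ T) (y θ : Fin n → ℝ) :
    l2Norm (θ - a) ≤ √s * T + √(2 * totalLoss T a y θ) := by
  choose w hw1 hw0 hw2 _ using fun i => exists_abs_sub_le_add hT (a i) (y i) (θ i)
  set v : Fin n → ℝ := fun i => if a i ≠ 0 then T else 0 with hv
  have hv0 : ∀ i, 0 ≤ v i := fun i => by
    simp only [hv]
    split_ifs <;> simp [hT]
  have h1 : l2Norm (θ - a) ≤ l2Norm (v + w) := by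
    rw [l2Norm_eq, l2Norm_eq]
    refine Real.sqrt_le_sqrt (Finset.sum_le_sum fun i _ => ?_)
    rw [Pi.sub_apply, Pi.add_apply, ← sq_abs]
    exact pow_le_pow_left₀ (abs_nonneg _) (hw1 i) 2
  have h2 : l2Norm (v + w) ≤ l2Norm v + l2Norm w := by
    simp only [l2Norm, WithLp.toLp_add]
    exact norm_add_le _ _
  have h3 : l2Norm v = √s * T := by
    have : ∀ i, v i ^ 2 = if a i ≠ 0 then T ^ 2 else 0 := fun i => by
      simp only [hv]
      split_ifs <;> simp
    rw [l2Norm_eq]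
    simp_rw [this]
    rw [sum_ite_ne_zero hs, Real.sqrt_mul (Nat.cast_nonneg s), Real.sqrt_sq hT]
  have h4 : l2Norm w ≤ √(2 * totalLoss T a y θ) := by
    rw [l2Norm_eq, totalLoss, Finset.mul_sum]
    exact Real.sqrt_le_sqrt (Finset.sum_le_sum fun i _ => hw2 i)
  linarith

theorem l1Norm_sub_le (hs : (Finset.univ.filter fun i => a i ≠ 0).card = s) {T : ℝ}
    (hT : 0 ≤ T) (y θ : Fin n → ℝ) :
    l1Norm (θ - a) ≤ s * T + s + totalLoss T a y θ := by
  choose w hw1 _ _ hw2 using fun i => exists_abs_sub_le_add hT (a i) (y i) (θ i)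
  rw [l1Norm, PiLp.norm_eq_of_L1]
  calc ∑ i, ‖(WithLp.toLp 1 (θ - a)).ofLp i‖
      ≤ ∑ i, ((if a i ≠ 0 then T else 0) + (if a i ≠ 0 then 1 else 0)
          + coordLoss T (a i) (y i) (θ i)) := by
        refine Finset.sum_le_sum fun i _ => ?_
        have h1 := hw1 i
        have h2 := hw2 i
        simp only [Pi.sub_apply, Real.norm_eq_abs]
        linarith
    _ = _ := by
        rw [Finset.sum_add_distrib, Finset.sum_add_distrib, sum_ite_ne_zero hs,
          sum_ite_ne_zero hs, mul_one, totalLoss]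

variable {p₀ : ℝ → ℝ} {τ : ℝ}

theorem lintegral_totalLoss_le (hdens : IsProbDensity p₀) (hτ : 0 < τ)
    (hs : (Finset.univ.filter fun i => a i ≠ 0).card = s) {T C₀ C₁ B : ℝ}
    (hC₀ : 0 ≤ C₀) (hC₁ : 0 ≤ C₁) (hB : 0 ≤ B)
    (hexc : ∀ y, ∫⁻ t, ENNReal.ofReal (excessSq T (t - y)) ∂(coordPosterior p₀ τ y)
        ≤ ENNReal.ofReal C₀)
    (hvar : ∀ t : ℝ,
      ∫⁻ y, ENNReal.ofReal ((y - t) ^ 2) ∂(gaussianReal t 1) ≤ ENNReal.ofReal C₁)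
    (hnull : ∫⁻ y, ∫⁻ t, ENNReal.ofReal (|t| + t ^ 2) ∂(coordPosterior p₀ τ y)
        ∂(gaussianReal 0 1) ≤ ENNReal.ofReal B) :
    ∫⁻ y, ∫⁻ θ, ENNReal.ofReal (totalLoss T a y θ) ∂(posteriorLaw p₀ τ y) ∂(dataLaw a)
      ≤ ENNReal.ofReal (s * (C₀ + C₁) + n * B) := by
  have hsum : ∀ y θ : Fin n → ℝ, ENNReal.ofReal (totalLoss T a y θ)
      = ∑ i, ENNReal.ofReal (coordLoss T (a i) (y i) (θ i)) := fun y θ =>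
    ENNReal.ofReal_sum_of_nonneg fun i _ => coordLoss_nonneg _ _ _ _
  simp_rw [hsum]
  rw [lintegral_posteriorLaw_sum hdens hτ a (f := fun i y t =>
    ENNReal.ofReal (coordLoss T (a i) y t)) fun i => measurable_coordLoss T (a i)]
  -- The null bound B is charged to every coordinate, which gives nB without counting the zeros.
  have hcoord : ∀ i, ∫⁻ y, ∫⁻ t, ENNReal.ofReal (coordLoss T (a i) y t)
      ∂(coordPosterior p₀ τ y) ∂(gaussianReal (a i) 1)
      ≤ ENNReal.ofReal ((if a i ≠ 0 then C₀ + C₁ else 0) + B) := by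
    intro i
    by_cases hi : a i ≠ 0
    · rw [if_pos hi]
      simp only [coordLoss, if_pos hi]
      calc _ ≤ ∫⁻ y, (ENNReal.ofReal C₀ + ENNReal.ofReal ((y - a i) ^ 2))
              ∂(gaussianReal (a i) 1) := by
            refine lintegral_mono fun y => ?_
            have := isProbabilityMeasure_coordPosterior hdens hτ y
            simp_rw [fun t => ENNReal.ofReal_add (excessSq_nonneg T (t - y))
              (sq_nonneg (y - a i))]
            rw [lintegral_add_right _ measurable_const, lintegral_const, measure_univ, mul_one]
            gcongr
            exact hexc y
        _ ≤ ENNReal.ofReal C₀ + ENNReal.ofReal C₁ := by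
            rw [lintegral_add_left measurable_const, lintegral_const, measure_univ, mul_one]
            gcongr
            exact hvar _
        _ = ENNReal.ofReal (C₀ + C₁) := (ENNReal.ofReal_add hC₀ hC₁).symm
        _ ≤ _ := ENNReal.ofReal_le_ofReal (by linarith)
    · rw [if_neg hi, zero_add]
      simp only [coordLoss, if_neg hi]
      rw [not_not.1 hi]
      exact hnull
  refine (Finset.sum_le_sum fun i _ => hcoord i).trans ?_
  rw [← ENNReal.ofReal_sum_of_nonneg]
  · rw [Finset.sum_add_distrib, sum_ite_ne_zero hs, Finset.sum_const, nsmul_eq_mul,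
      Finset.card_univ, Fintype.card_fin]
  · intro i _
    split_ifs <;> positivity

/-- Markov's inequality for each y, then averaging. The set E need not be measurable: it lies in a
superlevel set of the loss. -/
theorem lintegral_posteriorLaw_le_of_le_totalLoss {T R b : ℝ} (hb : 0 < b)
    (hR : ∫⁻ y, ∫⁻ θ, ENNReal.ofReal (totalLoss T a y θ) ∂(posteriorLaw p₀ τ y) ∂(dataLaw a)
      ≤ ENNReal.ofReal R) (E : Set (Fin n → ℝ))
    (hE : ∀ y, ∀ θ ∈ E, b ≤ totalLoss T a y θ) :
    ∫⁻ y, posteriorLaw p₀ τ y E ∂(dataLaw a) ≤ ENNReal.ofReal (R / b) := by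
  have hb' : ENNReal.ofReal b ≠ 0 := by simpa using hb
  rw [ENNReal.ofReal_div_of_pos hb, ENNReal.le_div_iff_mul_le (Or.inl hb')
    (Or.inl ENNReal.ofReal_ne_top), mul_comm, ← lintegral_const_mul' _ _ ENNReal.ofReal_ne_top]
  refine le_trans (lintegral_mono fun y => ?_) hR
  have hmeas : Measurable fun θ => ENNReal.ofReal (totalLoss T a y θ) := by
    simp_rw [totalLoss, ENNReal.ofReal_sum_of_nonneg fun i (_ : i ∈ Finset.univ) =>
      coordLoss_nonneg _ _ _ _]
    exact Finset.measurable_sum _ fun i _ =>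
      ((measurable_coordLoss T (a i)).comp measurable_prodMk_left).comp (measurable_pi_apply i)
  refine le_trans ?_ (mul_meas_ge_le_lintegral hmeas (ENNReal.ofReal b))
  gcongr
  exact fun θ hθ => ENNReal.ofReal_le_ofReal (hE y θ hθ)

end Loss

/-! ### Asymptotics -/

section Asymptotics

theorem tendsto_log_div_atTop {s : ℕ → ℕ} (hs_pos : ∀ n, 0 < n → 0 < s n)
    (hs_sparse : (fun n => (s n : ℝ)) =o[atTop] fun n => (n : ℝ)) :
    Tendsto (fun n : ℕ => Real.log (n / s n)) atTop atTop := by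
  refine Real.tendsto_log_atTop.comp ?_
  have h : Tendsto (fun n : ℕ => (s n : ℝ) / n) atTop (𝓝[>] 0) := by
    refine tendsto_nhdsWithin_iff.2 ⟨hs_sparse.tendsto_div_nhds_zero, ?_⟩
    filter_upwards [eventually_gt_atTop 0] with n hn
    have h1 : (0 : ℝ) < s n := Nat.cast_pos.2 (hs_pos n hn)
    have h2 : (0 : ℝ) < n := Nat.cast_pos.2 hn
    exact Set.mem_Ioi.2 (by positivity)
  refine h.inv_tendsto_nhdsGT_zero.congr fun n => ?_
  simp

/-- Bounds on the scale `τ n`, in terms of `L = log (n / s n)`, from its order of magnitude. -/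
theorem exists_scale_bounds {α c : ℝ} {s : ℕ → ℕ} {τ : ℕ → ℝ} (hα : 1 < α) (hαc : α ≤ c)
    (hs_pos : ∀ n, 0 < n → 0 < s n)
    (hs_sparse : (fun n => (s n : ℝ)) =o[atTop] fun n => (n : ℝ))
    (hτ_pos : ∀ n, 0 < τ n)
    (hτ : (fun n => τ n ^ (α - 1)) =Θ[atTop] fun n => ((s n : ℝ) / n) ^ c) :
    ∃ A q : ℝ, 0 < A ∧ 0 < q ∧ q ≤ 1 ∧ q < α - 1 ∧
      (∀ᶠ n in atTop, Real.exp (-(c * Real.log (n / s n))) ≤ A * τ n ^ (α - 1)) ∧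
      ∀ K : ℝ, ∀ᶠ n in atTop,
        K * Real.log (n / s n) * τ n ^ q ≤ Real.exp (-Real.log (n / s n)) := by
  have hc : 0 < c := by linarith
  have hα1 : 0 < α - 1 := by linarith
  -- The lower bound makes τ^q of order (s/n)^(cq/(α-1)) with exponent above 1, so that a factor L
  -- can be absorbed; q < α - 1 makes the prior moment finite. Such q exists since c ≥ α > 1.
  obtain ⟨q, hq1, hq2⟩ : ∃ q, (α - 1) / c < q ∧ q < min 1 (α - 1) := by
    refine exists_between (lt_min ?_ ?_)
    · rw [div_lt_one hc]
      linarith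
    · rw [div_lt_iff₀ hc]
      nlinarith
  have hq0 : 0 < q := lt_trans (by positivity) hq1
  obtain ⟨A₁, hA₁, hup⟩ := hτ.1.exists_pos
  obtain ⟨A₂, hA₂, hlow⟩ := hτ.2.exists_pos
  have hpow : ∀ᶠ n : ℕ in atTop,
      ((s n : ℝ) / n) ^ c = Real.exp (-(c * Real.log (n / s n))) := by
    filter_upwards [eventually_gt_atTop 0] with n hn
    have h1 : (0 : ℝ) < s n := Nat.cast_pos.2 (hs_pos n hn)
    have h2 : (0 : ℝ) < n := Nat.cast_pos.2 hn
    rw [← inv_div (n : ℝ) (s n : ℝ), Real.inv_rpow (by positivity),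
      Real.rpow_def_of_pos (by positivity), ← Real.exp_neg, mul_comm]
  refine ⟨A₂, q, hA₂, hq0, (hq2.trans_le (min_le_left _ _)).le, hq2.trans_le (min_le_right _ _),
    ?_, fun K => ?_⟩
  · filter_upwards [hlow.bound, hpow] with n h1 h2
    have h3 : 0 < τ n ^ (α - 1) := Real.rpow_pos_of_pos (hτ_pos n) _
    rwa [h2, Real.norm_of_nonneg (Real.exp_nonneg _), Real.norm_of_nonneg h3.le] at h1
  · set r := q / (α - 1) with hr
    have hr0 : 0 < r := by positivity
    have hδ : 0 < c * r - 1 := by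
      rw [div_lt_iff₀ hc] at hq1
      rw [hr, sub_pos, mul_div_assoc', lt_div_iff₀ hα1]
      linarith
    have hL := tendsto_log_div_atTop hs_pos hs_sparse
    have hlim : Tendsto (fun n : ℕ => |K| * A₁ ^ r * (Real.log (n / s n) ^ (1 : ℝ) *
        Real.exp (-(c * r - 1) * Real.log (n / s n)))) atTop (𝓝 (|K| * A₁ ^ r * 0)) :=
      ((tendsto_rpow_mul_exp_neg_mul_atTop_nhds_zero 1 _ hδ).comp hL).const_mul _
    rw [mul_zero] at hlim
    filter_upwards [hup.bound, hpow, hlim.eventually_le_const one_pos,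
      hL.eventually_ge_atTop 0] with n h1 h2 h3 h4
    have h5 : 0 < τ n ^ (α - 1) := Real.rpow_pos_of_pos (hτ_pos n) _
    set L := Real.log (n / s n) with hLdef
    rw [h2, Real.norm_of_nonneg (Real.exp_nonneg _), Real.norm_of_nonneg h5.le] at h1
    have h6 : τ n ^ q ≤ A₁ ^ r * Real.exp (-(c * r * L)) := by
      calc τ n ^ q = (τ n ^ (α - 1)) ^ r := by
            rw [← Real.rpow_mul (hτ_pos n).le, hr]
            congr 1
            field_simp
        _ ≤ (A₁ * Real.exp (-(c * L))) ^ r := by gcongr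
        _ = _ := by
            rw [Real.mul_rpow hA₁.le (Real.exp_nonneg _), ← Real.exp_mul]
            congr 2
            ring
    rw [Real.rpow_one] at h3
    have h7 : Real.exp (-(c * r * L)) = Real.exp (-(c * r - 1) * L) * Real.exp (-L) := by
      rw [← Real.exp_add]
      congr 1
      ring
    have hq : 0 ≤ τ n ^ q := (Real.rpow_pos_of_pos (hτ_pos n) _).le
    calc K * L * τ n ^ q ≤ |K| * L * τ n ^ q := by
          gcongr
          exact le_abs_self K
      _ ≤ |K| * L * (A₁ ^ r * Real.exp (-(c * r * L))) := by gcongr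
      _ = |K| * A₁ ^ r * (L * Real.exp (-(c * r - 1) * L)) * Real.exp (-L) := by
          rw [h7]
          ring
      _ ≤ 1 * Real.exp (-L) := by gcongr
      _ = _ := one_mul _

/-- With thresholds `√(2 b log (n / s))` for some `b > c`, the loss is of order `s` on average. -/
theorem exists_lintegral_totalLoss_le {p₀ : ℝ → ℝ} {α b c : ℝ} {s : ℕ → ℕ} {τ : ℕ → ℝ}
    {θstar : (n : ℕ) → Fin n → ℝ} (hdens : IsProbDensity p₀) (huni : IsUnimodalAtZero p₀)
    (htail : HasPolynomialTail p₀ α) (hs_pos : ∀ n, 0 < n → 0 < s n)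
    (hs_card : ∀ n, (Finset.univ.filter fun i => θstar n i ≠ 0).card = s n)
    (hs_sparse : (fun n => (s n : ℝ)) =o[atTop] fun n => (n : ℝ))
    (hαc : α ≤ c) (hcb : c < b) (hτ_pos : ∀ n, 0 < τ n)
    (hτ : (fun n => τ n ^ (α - 1)) =Θ[atTop] fun n => ((s n : ℝ) / n) ^ c) :
    ∃ C : ℝ, 0 < C ∧ ∀ᶠ n : ℕ in atTop,
      ∫⁻ y, ∫⁻ θ, ENNReal.ofReal
          (totalLoss (√(2 * b) * √(Real.log (n / s n))) (θstar n) y θ)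
        ∂(posteriorLaw p₀ (τ n) y) ∂(dataLaw (θstar n)) ≤ ENNReal.ofReal (C * s n) := by
  obtain ⟨hα, M, K₁, K₂, hM, hK₁, hK₁₂, htail⟩ := htail
  have hK₂ : 0 < K₂ := hK₁.trans hK₁₂
  have hc : 0 < c := by linarith
  have hb : 0 < b := hc.trans hcb
  obtain ⟨A, q, hA, hq, hq1, hqα, hlow, hup⟩ :=
    exists_scale_bounds hα hαc hs_pos hs_sparse hτ_pos hτ
  -- With η = 1 - c/b one has (1-η)T²/2 = cL, so the Gaussian factor is exactly (s/n)^c; η > 0 is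
  -- the gap between c and b.
  have hη : 0 < 1 - c / b := by rwa [sub_pos, div_lt_one hb]
  have hη1 : 1 - c / b < 1 := by
    have : 0 < c / b := by positivity
    linarith
  obtain ⟨C₀, hC₀, hexc⟩ := exists_lintegral_excessSq_coordPosterior_le hdens hα hK₁ hK₂
    htail hη hη1 hA
  obtain ⟨C₁, hC₁, hvar⟩ := exists_lintegral_sq_gaussianReal_le
  obtain ⟨C₂, hC₂, hnull⟩ := exists_lintegral_null_le hdens huni hα hM hK₁ hK₂ htail
    hη hη1 hA hq hq1 hqα
  refine ⟨C₀ + C₁ + 2 * C₂, by positivity, ?_⟩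
  have hL := tendsto_log_div_atTop hs_pos hs_sparse
  have hexpL : Tendsto (fun n : ℕ => M * Real.exp (-Real.log (n / s n))) atTop (𝓝 (M * 0)) :=
    (Real.tendsto_exp_neg_atTop_nhds_zero.comp hL).const_mul M
  rw [mul_zero] at hexpL
  filter_upwards [hlow, hup (2 * b), hL.eventually_ge_atTop 1,
    hL.eventually_ge_atTop (1 / (2 * b)), hexpL.eventually_lt_const one_pos,
    eventually_gt_atTop 0] with n h1 h2 h3 h4 h5 hn
  have hs0 : (0 : ℝ) < s n := Nat.cast_pos.2 (hs_pos n hn)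
  have hn0 : (0 : ℝ) < n := Nat.cast_pos.2 hn
  have hexp : Real.exp (-Real.log (n / s n)) = s n / n := by
    rw [Real.exp_neg, Real.exp_log (by positivity), inv_div]
  set L := Real.log (n / s n) with hLdef
  set T := √(2 * b) * √L with hT
  have hL0 : 0 ≤ L := by linarith
  have hT2 : T ^ 2 = 2 * b * L := by
    rw [hT, mul_pow, Real.sq_sqrt (by positivity), Real.sq_sqrt hL0]
  have hT1 : 1 ≤ T := by
    rw [div_le_iff₀ (by positivity)] at h4
    rw [hT, ← Real.sqrt_mul (by positivity), Real.one_le_sqrt]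
    linarith
  have hτn := hτ_pos n
  have hτq : 0 < τ n ^ q := Real.rpow_pos_of_pos hτn q
  -- Now T² τ^q ≤ exp(-L) = s/n. Every smallness condition on τ below follows from this, T ≥ 1 and q
  -- ≤ 1.
  rw [← hT2] at h2
  have hexp1 : Real.exp (-L) ≤ 1 := Real.exp_le_one_iff.2 (by linarith)
  have hτq1 : τ n ^ q ≤ Real.exp (-L) :=
    (le_mul_of_one_le_left hτq.le (one_le_pow₀ hT1)).trans h2
  have hτ1 : τ n ≤ 1 := by
    by_contra! h
    exact absurd (hτq1.trans hexp1) (not_le.2 (Real.one_lt_rpow h hq))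
  have hττq : τ n ≤ τ n ^ q := by
    simpa using Real.rpow_le_rpow_of_exponent_ge hτn hτ1 hq1
  have hTτ : T * τ n ≤ 1 := by
    refine le_trans ?_ (h2.trans hexp1)
    gcongr
    exact le_self_pow₀ hT1 two_ne_zero
  have hMτ : M * τ n < 1 := by
    refine lt_of_le_of_lt ?_ h5
    gcongr
    exact hττq.trans hτq1
  have hET : Real.exp (-((1 - (1 - c / b)) * T ^ 2 / 2)) = Real.exp (-(c * L)) := by
    rw [hT2]
    congr 1
    field_simp
    ring
  have hexpA : Real.exp (-((1 - (1 - c / b)) * T ^ 2 / 2)) ≤ A * τ n ^ (α - 1) := by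
    rw [hET]
    exact h1
  have hB : C₂ * (T ^ 2 * τ n ^ q + Real.exp (-((1 - (1 - c / b)) * T ^ 2 / 2)))
      ≤ C₂ * (2 * (s n / n)) := by
    rw [hET, ← hexp, two_mul]
    gcongr
    nlinarith [hc, hα]
  refine (lintegral_totalLoss_le hdens hτn (hs_card n) hC₀.le hC₁.le
    (B := C₂ * (2 * (s n / n))) (by positivity)
    (fun y => hexc (τ n) T y hτn hMτ (by linarith) hexpA) hvar
    ((hnull (τ n) T hτn hτ1 hMτ hT1 hTτ hexpA).trans
      (ENNReal.ofReal_le_ofReal hB))).trans (ENNReal.ofReal_le_ofReal (le_of_eq ?_))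
  field_simp

end Asymptotics

theorem corollary1
    (p₀ : ℝ → ℝ) (α ω c : ℝ) (s : ℕ → ℕ) (τ : ℕ → ℝ) (θstar : (n : ℕ) → Fin n → ℝ)
    -- the prior density
    (hdens : IsProbDensity p₀) (huni : IsUnimodalAtZero p₀) (htail : HasPolynomialTail p₀ α)
    -- the sparse truth: `θstar n` has exactly `s n` nonzero entries, and `s = o(n)`
    (hs_pos : ∀ n, 0 < n → 0 < s n)
    (hs_card : ∀ n, (Finset.univ.filter fun i => θstar n i ≠ 0).card = s n)
    (hs_sparse : (fun n => (s n : ℝ)) =o[atTop] fun n => (n : ℝ))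
    -- the global shrinkage parameter
    (hω : 0 < ω) (hα : α ≤ 1 + ω / 2) (hc : c ∈ Set.Ico α (1 + ω / 2))
    (hτ_pos : ∀ n, 0 < τ n)
    (hτ : (fun n => τ n ^ (α - 1)) =Θ[atTop] fun n => ((s n : ℝ) / n) ^ c) :
    -- contraction in the Euclidean norm
    Tendsto (fun n : ℕ => ∫⁻ y, posteriorLaw p₀ (τ n) y
        {θ | sharpC₁ ω * √(s n * Real.log (n / s n)) ≤ l2Norm (θ - θstar n)}
        ∂(dataLaw (θstar n))) atTop (𝓝 0) ∧
    Tendsto sharpC₁ (𝓝[>] 0) (𝓝 √2) ∧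
    -- contraction in the `ℓ¹` norm
    Tendsto (fun n : ℕ => ∫⁻ y, posteriorLaw p₀ (τ n) y
        {θ | s n * sharpC₂ ω * √(Real.log (n / s n)) ≤ l1Norm (θ - θstar n)}
        ∂(dataLaw (θstar n))) atTop (𝓝 0) ∧
    Tendsto sharpC₂ (𝓝[>] 0) (𝓝 √2) := by
  -- The gap c < b pays for the posterior bounds; b < 1 + ω/2 leaves room κ below the claimed
  -- constants.
  obtain ⟨b, hcb, hbω⟩ := exists_between hc.2
  obtain ⟨C, hC, hloss⟩ := exists_lintegral_totalLoss_le hdens huni htail hs_pos hs_card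
    hs_sparse hc.1 hcb hτ_pos hτ
  have hL := tendsto_log_div_atTop hs_pos hs_sparse
  have hsqrt : √(2 * b) < √(2 + ω) := Real.sqrt_lt_sqrt
    (by linarith [hc.1, htail.1]) (by linarith)
  have hκ₁ : 0 < sharpC₁ ω - √(2 * b) := by
    rw [sharpC₁]
    linarith [Real.sqrt_nonneg ω]
  have hκ₂ : 0 < sharpC₂ ω - √(2 * b) := by
    rw [sharpC₂]
    linarith [Real.sqrt_nonneg (ω ^ 2 / 5), Real.sqrt_nonneg (ω / 5)]
  refine ⟨?_, ?_, ?_, ?_⟩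
  · set κ := sharpC₁ ω - √(2 * b) with hκ
    have hlim : Tendsto (fun n : ℕ => ENNReal.ofReal (2 * C / κ ^ 2 / Real.log (n / s n)))
        atTop (𝓝 0) := by
      simpa using ENNReal.tendsto_ofReal (hL.const_div_atTop (2 * C / κ ^ 2))
    refine tendsto_of_tendsto_of_tendsto_of_le_of_le' tendsto_const_nhds hlim
      (Eventually.of_forall fun _ => zero_le) ?_
    filter_upwards [hloss, hL.eventually_gt_atTop 0, eventually_gt_atTop 0] with n h1 hL0 hn
    have hs0 : (0 : ℝ) < s n := Nat.cast_pos.2 (hs_pos n hn)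
    set L := Real.log (n / s n) with hLdef
    have hE : ∀ y, ∀ θ ∈ {θ | sharpC₁ ω * √(s n * L) ≤ l2Norm (θ - θstar n)},
        κ ^ 2 * (s n * L) / 2 ≤ totalLoss (√(2 * b) * √L) (θstar n) y θ := by
      intro y θ hθ
      have h2 := l2Norm_sub_le (hs_card n) (T := √(2 * b) * √L) (by positivity) y θ
      have h3 : κ * √(s n * L) ≤ √(2 * totalLoss (√(2 * b) * √L) (θstar n) y θ) := by
        have h4 : √(s n * L) = √(s n) * √L := Real.sqrt_mul hs0.le _
        have h5 : sharpC₁ ω * √(s n * L) ≤ l2Norm (θ - θstar n) := hθ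
        rw [h4] at h5 ⊢
        rw [hκ]
        linarith
      have h6 := pow_le_pow_left₀ (by positivity) h3 2
      rw [mul_pow, Real.sq_sqrt (by positivity),
        Real.sq_sqrt (mul_nonneg zero_le_two (totalLoss_nonneg _ _ _ _))] at h6
      linarith
    refine (lintegral_posteriorLaw_le_of_le_totalLoss (by positivity) h1 _ hE).trans
      (ENNReal.ofReal_le_ofReal (le_of_eq ?_))
    field_simp
  · have h : Continuous sharpC₁ := by
      unfold sharpC₁
      fun_prop
    have h0 : sharpC₁ 0 = √2 := by simp [sharpC₁]
    rw [← h0]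
    exact h.continuousAt.tendsto.mono_left nhdsWithin_le_nhds
  -- The -1 in the next line is the extra s of the ℓ¹ bound; it is harmless because κ√L tends to
  -- infinity.
  · set κ := sharpC₂ ω - √(2 * b) with hκ
    have hden : Tendsto (fun n : ℕ => κ * √(Real.log (n / s n)) - 1) atTop atTop :=
      tendsto_atTop_add_const_right _ _
        ((Real.tendsto_sqrt_atTop.comp hL).const_mul_atTop hκ₂)
    have hlim : Tendsto (fun n : ℕ => ENNReal.ofReal (C / (κ * √(Real.log (n / s n)) - 1)))
        atTop (𝓝 0) := by
      simpa using ENNReal.tendsto_ofReal (hden.const_div_atTop C)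
    refine tendsto_of_tendsto_of_tendsto_of_le_of_le' tendsto_const_nhds hlim
      (Eventually.of_forall fun _ => zero_le) ?_
    filter_upwards [hloss, hden.eventually_gt_atTop 0, eventually_gt_atTop 0] with n h1 hd hn
    have hs0 : (0 : ℝ) < s n := Nat.cast_pos.2 (hs_pos n hn)
    set L := Real.log (n / s n) with hLdef
    have hE : ∀ y, ∀ θ ∈ {θ | s n * sharpC₂ ω * √L ≤ l1Norm (θ - θstar n)},
        s n * (κ * √L - 1) ≤ totalLoss (√(2 * b) * √L) (θstar n) y θ := by
      intro y θ hθ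
      have h2 := l1Norm_sub_le (hs_card n) (T := √(2 * b) * √L) (by positivity) y θ
      have h5 : s n * sharpC₂ ω * √L ≤ l1Norm (θ - θstar n) := hθ
      rw [hκ]
      linarith
    refine (lintegral_posteriorLaw_le_of_le_totalLoss (by positivity) h1 _ hE).trans
      (ENNReal.ofReal_le_ofReal (le_of_eq ?_))
    field_simp
  · have h : Continuous sharpC₂ := by
      unfold sharpC₂
      fun_prop
    have h0 : sharpC₂ 0 = √2 := by simp [sharpC₂]
    rw [← h0]
    exact h.continuousAt.tendsto.mono_left nhdsWithin_le_nhds
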